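/- **Lemma (Well-posedness of the DMH-RT0 discrete problem).** Let $\Omega\subset\mathbb R^3$ be a bounded open polyhedral set with boundary $\Sigma=\partial\Omega$, divided into two disjoint open polyhedral subregions $\Omega_1,\Omega_2$ (each equal to the interior of its closure) with $\Omega=\operatorname{int}(\overline\Omega_1\cup\overline\Omega_2)$, and let $\Gamma=\partial\Omega_1\cap\partial\Omega_2$. Let $\mathcal T_h=\mathcal T_{h,1}\cup\mathcal T_{h,2}$ be a finite conforming triangulation of $\Omega$ by closed nondegenerate tetrahedra (any two elements meet in the convex hull of their common vertices) such that $\overline\Omega_i$ is the union of the elements of $\mathcal T_{h,i}$, $i=1,2$. Let $\mathcal F_{h,i}$ be the set of all faces of elements of $\mathcal T_{h,i}$, $\mathcal F_{h,\Gamma}$ the set of faces contained in $\Gamma$, $\mathcal F_{h,\Gamma,i}=\mathcal F_{h,i}\cap\mathcal F_{h,\Gamma}$, and $\mathcal F_{h,\Sigma_i}$ the set of faces in $\mathcal F_{h,i}$ contained in $\Sigma$. Let $\mu,r:\Omega\to\mathbb R$ be measurable with $0<\mu_{min}\le\mu\le\mu_{max}<\infty$ and $0<r_{min}\le r\le r_{max}<\infty$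 a.e. in $\Omega$; let $g\in L^2(\Omega)$; let $\mathbf v\in (L^\infty(\Omega))^3$ satisfy $$\|\mathbf v\|_{\infty,\Omega}<2\,\mu_{min}\min\{\mu_{max}^{-1},r_{min}\},$$ where $\|\mathbf v\|_{\infty,\Omega}$ is the essential supremum of the Euclidean norm $|\mathbf v|$; let $\alpha\in L^\infty(\Sigma)$ with $\alpha>0$ a.e. on $\Sigma$, $\beta\in L^2(\Sigma)$, $\sigma\in L^2(\Gamma)$, and let $\kappa>0$ be a constant. Let $\mathcal V_h=\mathbf V_{1,h}\times V_{1,h}\times\mathbf V_{2,h}\times V_{2,h}$ and $\mathcal Q_h=M_{1,h}\times M_{2,h}\times M_{J,1,h}\times M_{J,2,h}\times M_{\lambda,h}$, where $\mathbf V_{i,h}$ consists of the fields whose restriction to each $K\in\mathcal T_{h,i}$ lies in $RT_0(K)=(\mathbb P_0(K))^3\oplus\mathbb P_0(K)\,\mathbf x$; $V_{i,h}$ of the functions constant on each $K\in\mathcal T_{h,i}$; and $M_{i,h}$, $M_{J,i,h}$, $M_{\lambda,h}$ of the functions constant on each face of $\mathcal F_{h,i}$, $\mathcal F_{h,\Gamma,i}$,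 $\mathcal F_{h,\Gamma}$, respectively (no continuity between elements or faces is required; functions in $M_{i,h}$ are single-valued on each face of $\mathcal F_{h,i}$). For ${\tt u}=(\mathbf J_1,u_1,\mathbf J_2,u_2)$, ${\tt v}=(\boldsymbol\tau_1,\phi_1,\boldsymbol\tau_2,\phi_2)$ in $\mathcal V_h$ and ${\tt p}=(\widehat u_1,\widehat u_2,\mathcal J_1,\mathcal J_2,\lambda)$, ${\tt q}=(\mu_1,\mu_2,\rho_1,\rho_2,\varphi)$ in $\mathcal Q_h$ set, with $\kappa_1=1$, $\kappa_2=\kappa$, $(\cdot,\cdot)_S$ the $L^2(S)$ scalar product, $(\cdot,\cdot)_i=(\cdot,\cdot)_{\Omega_i}$ and $\mathbf n_{\partial K}$ the outward unit normal, $$a({\tt u},{\tt v})=\sum_{i=1}^2\Big[(\mu^{-1}\mathbf J_i,\boldsymbol\tau_i)_i-(\mu^{-1}\mathbf v u_i,\boldsymbol\tau_i)_i+(r u_i,\phi_i)_i-\sum_{K\in\mathcal T_{h,i}}(u_i,\operatorname{div}\boldsymbol\tau_i)_K+\sum_{K\in\mathcal T_{h,i}}(\phi_i,\operatorname{div}\mathbf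 J_i)_K\Big],$$ $$b({\tt u},{\tt q})=\sum_{i=1}^2\sum_{K\in\mathcal T_{h,i}}(\mathbf J_i\cdot\mathbf n_{\partial K},\mu_i)_{\partial K},$$ $$c({\tt p},{\tt q})=\sum_{i=1}^2\Big[\sum_{F\in\mathcal F_{h,\Sigma_i}}(\alpha\widehat u_i,\mu_i)_F-\sum_{F\in\mathcal F_{h,\Gamma,i}}(\rho_i,\widehat u_i)_F+\sum_{F\in\mathcal F_{h,\Gamma,i}}(\rho_i,\kappa_i\lambda)_F+\sum_{F\in\mathcal F_{h,\Gamma,i}}(\mathcal J_i,\mu_i)_F-\sum_{F\in\mathcal F_{h,\Gamma}}(\mathcal J_i,\varphi)_F\Big],$$ $$F({\tt v})=\sum_{i=1}^2(g,\phi_i)_i,\qquad G({\tt q})=-\sum_{i=1}^2\sum_{F\in\mathcal F_{h,\Sigma_i}}(\beta,\mu_i)_F-\sum_{F\in\mathcal F_{h,\Gamma}}(\sigma,\varphi)_F.$$ Then the DMH-RT0 Galerkin problem: find $({\tt u}_h,{\tt p}_h)\in\mathcal V_h\times\mathcal Q_h$ such that $$a({\tt u}_h,{\tt v}_h)+b({\tt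 v}_h,{\tt p}_h)=F({\tt v}_h)\quad\forall\,{\tt v}_h\in\mathcal V_h,\qquad b({\tt u}_h,{\tt q}_h)-c({\tt p}_h,{\tt q}_h)=G({\tt q}_h)\quad\forall\,{\tt q}_h\in\mathcal Q_h,$$ has a unique solution. -/

import Mathlib

open MeasureTheory

namespace DMH

/-- Physical space `ℝ³` with its Euclidean norm. -/
abbrev E3 := EuclideanSpace ℝ (Fin 3)

/-- A bounded open set `Ω` divided into two open subregions `Ωs 0` and `Ωs 1` (written `Ω₁`, `Ω₂` in
the comments below), separated by the interface `∂Ω₁ ∩ ∂Ω₂`.  The regions coincide with the interior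
of their closures (no slits), and `Ω₁`, `Ω₂` and the interface between them fill up `Ω`. -/
structure IsInterfaceDomain (Ω : Set E3) (Ωs : Fin 2 → Set E3) : Prop where
  isOpen : IsOpen Ω
  isBounded : Bornology.IsBounded Ω
  sub_isOpen : ∀ i, IsOpen (Ωs i)
  sub_regular : ∀ i, interior (closure (Ωs i)) = Ωs i
  sub_disjoint : Disjoint (Ωs 0) (Ωs 1)
  eq_interior : Ω = interior (closure (Ωs 0) ∪ closure (Ωs 1))

/-- An admissible (conforming) triangulation of `Ω` by closed tetrahedra which exactly covers each of
the two subregions.  A tetrahedron is given by its set of four affinely independent vertices, the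
closed element being the convex hull of the vertices; any two elements (of the same or of different
subregions) meet exactly in the convex hull of their common vertices, i.e. the intersection is empty
or a common vertex, edge, face (or the elements are equal). -/
structure Mesh (Ω : Set E3) (Ωs : Fin 2 → Set E3) where
  /-- `elems i` is the triangulation `𝒯_{h,i}` of the `i`-th subregion. -/
  elems : Fin 2 → Finset (Finset E3)
  card_eq : ∀ i, ∀ K ∈ elems i, K.card = 4
  affineIndep : ∀ i, ∀ K ∈ elems i, AffineIndependent ℝ ((↑) : K → E3)
  conforming : ∀ i j, ∀ K ∈ elems i, ∀ K' ∈ elems j,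
    convexHull ℝ (K : Set E3) ∩ convexHull ℝ (K' : Set E3) =
      convexHull ℝ ((K : Set E3) ∩ (K' : Set E3))
  cover : ∀ i, closure (Ωs i) = ⋃ K ∈ elems i, convexHull ℝ (K : Set E3)

/-- The closed simplex spanned by a finite set of vertices. -/
abbrev hull (S : Finset E3) : Set E3 := convexHull ℝ (S : Set E3)

/-- Surface (two-dimensional Euclidean area) measure. -/
noncomputable abbrev area : Measure E3 := μHE[2]

open Classical in
/-- The face of the tetrahedron `K` opposite to the vertex `P`. -/
noncomputable def oppFace (K : Finset E3) (P : E3) : Finset E3 := K.erase P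

/-- The component orthogonal to the face opposite to `P` of the vector pointing from the vertex `P`
to the barycenter of that face. -/
noncomputable def normalDir (K : Finset E3) (P : E3) : E3 :=
  ((vectorSpan ℝ (oppFace K P : Set E3))ᗮ).starProjection ((oppFace K P).centroid ℝ id - P)

/-- The unit normal vector, outward with respect to `K`, on the face of `K` opposite to `P`. -/
noncomputable def outwardNormal (K : Finset E3) (P : E3) : E3 :=
  ‖normalDir K P‖⁻¹ • normalDir K P

/-- `ℙ₀`: constant functions. -/
def P0 : Submodule ℝ (E3 → ℝ) where
  carrier := {f | ∃ c : ℝ, ∀ x, f x = c}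
  zero_mem' := ⟨0, fun _ => rfl⟩
  add_mem' := by
    rintro f g ⟨c, hc⟩ ⟨d, hd⟩
    exact ⟨c + d, fun x => by simp [hc, hd]⟩
  smul_mem' := by
    rintro t f ⟨c, hc⟩
    exact ⟨t * c, fun x => by simp [hc]⟩

/-- The lowest order Raviart–Thomas space `RT₀ = (ℙ₀)³ ⊕ ℙ₀ x`. -/
def RT0 : Submodule ℝ (E3 → E3) where
  carrier := {τ | ∃ (a : E3) (b : ℝ), ∀ x, τ x = a + b • x}
  zero_mem' := ⟨0, 0, fun _ => by simp⟩
  add_mem' := by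
    rintro f g ⟨a, b, h⟩ ⟨a', b', h'⟩
    exact ⟨a + a', b + b', fun x => by simp only [Pi.add_apply, h, h']; module⟩
  smul_mem' := by
    rintro t f ⟨a, b, h⟩
    exact ⟨t • a, t * b, fun x => by simp only [Pi.smul_apply, h]; module⟩

/-- The divergence of a differentiable vector field. -/
noncomputable def divergence (τ : E3 → E3) (x : E3) : ℝ :=
  ∑ j, (fderiv ℝ τ x (EuclideanSpace.single j 1)) j

/-- The coefficients and data of the transmission problem (with `γ = 1`). -/
structure Data where
  /-- diffusivity `μ` -/
  mu : E3 → ℝ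
  /-- advection field `𝐯` -/
  vel : E3 → E3
  /-- reaction coefficient `r` -/
  r : E3 → ℝ
  /-- volume source `g` -/
  g : E3 → ℝ
  /-- Robin coefficient `α` on `Σ` -/
  alpha : E3 → ℝ
  /-- Robin datum `β` on `Σ` -/
  beta : E3 → ℝ
  /-- interface source `σ` on `Γ` -/
  sigma : E3 → ℝ
  /-- segregation constant `κ` -/
  kappa : ℝ

namespace Data

/-- The factor `1` (first subregion) or `κ` (second subregion) multiplying `λ` in the transmission
conditions `û₁ = λ`, `û₂ = κ λ` on the interface. -/
def seg (d : Data) : Fin 2 → ℝ := ![1, d.kappa]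

end Data

/-- The interface `Γ = ∂Ω₁ ∩ ∂Ω₂`. -/
def interface (Ωs : Fin 2 → Set E3) : Set E3 := frontier (Ωs 0) ∩ frontier (Ωs 1)

namespace Mesh

variable {Ω : Set E3} {Ωs : Fin 2 → Set E3}

open Classical in
/-- `ℱ_{h,i}`: all the (triangular) faces of the elements of `𝒯_{h,i}`. -/
noncomputable def faces (M : Mesh Ω Ωs) (i : Fin 2) : Finset (Finset E3) :=
  (M.elems i).biUnion fun K => K.image fun P => oppFace K P

open Classical in
/-- `ℱ_{h,Γ}`: the faces of the triangulation that lie on the interface `Γ`. -/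
noncomputable def interfaceFaces (M : Mesh Ω Ωs) : Finset (Finset E3) :=
  (M.faces 0 ∪ M.faces 1).filter fun F => hull F ⊆ interface Ωs

open Classical in
/-- `ℱ_{h,Γ,i} = ℱ_{h,i} ∩ ℱ_{h,Γ}`. -/
noncomputable def interfaceFacesOf (M : Mesh Ω Ωs) (i : Fin 2) : Finset (Finset E3) :=
  M.faces i ∩ M.interfaceFaces

open Classical in
/-- `ℱ_{h,Σ_i}`: the faces of `𝒯_{h,i}` that lie on the outer boundary `Σ = ∂Ω`. -/
noncomputable def boundaryFaces (M : Mesh Ω Ωs) (i : Fin 2) : Finset (Finset E3) :=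
  (M.faces i).filter fun F => hull F ⊆ frontier Ω

theorem oppFace_mem (M : Mesh Ω Ωs) {i : Fin 2} {K : Finset E3} (hK : K ∈ M.elems i) {P : E3}
    (hP : P ∈ K) : oppFace K P ∈ M.faces i := by
  classical
  exact Finset.mem_biUnion.2 ⟨K, hK, Finset.mem_image.2 ⟨P, hP, rfl⟩⟩

theorem boundaryFaces_subset (M : Mesh Ω Ωs) (i : Fin 2) : M.boundaryFaces i ⊆ M.faces i := by
  classical
  exact Finset.filter_subset _ _

theorem interfaceFacesOf_subset (M : Mesh Ω Ωs) (i : Fin 2) :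
    M.interfaceFacesOf i ⊆ M.faces i := by
  classical
  exact Finset.inter_subset_left

/-- Since the triangulations of the two subregions match at the interface, every face on `Γ` is a
face of both of them. -/
theorem interfaceFaces_subset_faces (M : Mesh Ω Ωs) (i : Fin 2) :
    M.interfaceFaces ⊆ M.faces i := by
  classical
  intro F hF
  obtain ⟨hF, hΓ⟩ := Finset.mem_filter.1 hF
  obtain ⟨j, K, hK, P, hP, rfl⟩ : ∃ j, ∃ K ∈ M.elems j, ∃ P ∈ K, oppFace K P = F := by
    rcases Finset.mem_union.1 hF with h | h <;>
    · obtain ⟨K, hK, h⟩ := Finset.mem_biUnion.1 h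
      obtain ⟨P, hP, h⟩ := Finset.mem_image.1 h
      exact ⟨_, K, hK, P, hP, h⟩
  have hFK : oppFace K P ⊆ K := Finset.erase_subset _ _
  have hcard : (oppFace K P).card = 3 := by
    rw [oppFace, Finset.card_erase_of_mem hP, M.card_eq j K hK]
  have hne : (oppFace K P).Nonempty := Finset.card_pos.1 (by omega)
  have hsub : hull (oppFace K P) ⊆ closure (Ωs i) := by
    intro x hx
    have h := hΓ hx
    fin_cases i
    · exact frontier_subset_closure h.1
    · exact frontier_subset_closure h.2
  have hc := Finset.centroid_mem_convexHull (R := ℝ) (oppFace K P) hne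
  have hc' := hsub hc
  rw [M.cover i] at hc'
  obtain ⟨K', hK', hcK'⟩ := Set.mem_iUnion₂.1 hc'
  have h1 : (oppFace K P).centroid ℝ id ∈ convexHull ℝ ((K ∩ K' : Finset E3) : Set E3) := by
    rw [Finset.coe_inter, ← M.conforming j i K hK K' hK']
    exact ⟨convexHull_mono (Finset.coe_subset.2 hFK) hc, hcK'⟩
  have h2 : (oppFace K P).centroid ℝ id ∈
      convexHull ℝ ((oppFace K P : Set E3) ∩ ((K ∩ K' : Finset E3) : Set E3)) := by
    rw [(M.affineIndep j K hK).convexHull_inter hFK Finset.inter_subset_left]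
    exact ⟨hc, h1⟩
  have hind : AffineIndependent ℝ ((↑) : oppFace K P → E3) :=
    (M.affineIndep j K hK).mono (Finset.coe_subset.2 hFK)
  have hFK' : oppFace K P ⊆ K' := by
    intro y hy
    by_contra hyK'
    have hw : ∑ k ∈ (Finset.univ : Finset (oppFace K P)),
        Finset.univ.centroidWeights ℝ k = 1 :=
      Finset.sum_centroidWeights_eq_one_of_nonempty ℝ _ ⟨⟨y, hy⟩, Finset.mem_univ _⟩
    have hm : (Finset.univ : Finset (oppFace K P)).affineCombination ℝ ((↑) : oppFace K P → E3)
        (Finset.univ.centroidWeights ℝ) ∈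
          affineSpan ℝ (((↑) : oppFace K P → E3) '' {z | (z : E3) ∈ K'}) := by
      have h3 : (Finset.univ : Finset (oppFace K P)).affineCombination ℝ
          ((↑) : oppFace K P → E3) (Finset.univ.centroidWeights ℝ) =
          (oppFace K P).centroid ℝ id := Finset.centroid_univ ℝ (oppFace K P)
      rw [h3]
      refine convexHull_subset_affineSpan _ (convexHull_mono ?_ h2)
      rintro z ⟨hz, hz'⟩
      exact ⟨⟨z, hz⟩, (Finset.mem_inter.1 (Finset.mem_coe.1 hz')).2, rfl⟩
    have h0 := hind.eq_zero_of_affineCombination_mem_affineSpan hw hm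
      (Finset.mem_univ ⟨y, hy⟩) (fun h => hyK' h)
    rw [Finset.centroidWeights_apply, inv_eq_zero, Nat.cast_eq_zero, Finset.card_eq_zero] at h0
    exact Finset.notMem_empty (⟨y, hy⟩ : oppFace K P) (h0 ▸ Finset.mem_univ _)
  have hsd : (K' \ oppFace K P).card = 1 := by
    rw [Finset.card_sdiff_of_subset hFK', M.card_eq i K' hK', hcard]
  obtain ⟨P', hP'⟩ := Finset.card_eq_one.1 hsd
  have hP'K : P' ∈ K' \ oppFace K P := hP' ▸ Finset.mem_singleton_self P'
  have heq : oppFace K' P' = oppFace K P := by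
    rw [oppFace, Finset.erase_eq, ← hP', Finset.sdiff_sdiff_eq_self hFK']
  exact heq ▸ M.oppFace_mem hK' (Finset.mem_sdiff.1 hP'K).1

/-- `ℱ_{h,Γ,1} = ℱ_{h,Γ,2} = ℱ_{h,Γ}`. -/
theorem interfaceFacesOf_eq (M : Mesh Ω Ωs) (i : Fin 2) :
    M.interfaceFacesOf i = M.interfaceFaces := by
  classical
  exact Finset.inter_eq_right.2 (M.interfaceFaces_subset_faces i)

/-- `𝒱_h = 𝐕_{1,h} × V_{1,h} × 𝐕_{2,h} × V_{2,h}`.  For each subregion `i`, a member consists of a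
flux, which is an `RT₀` field on every element of `𝒯_{h,i}`, and of a primal variable, which is
constant on every element of `𝒯_{h,i}`; there is no continuity between elements.  A polynomial
function on an element is identified with the polynomial that it comes from. -/
abbrev Vh (M : Mesh Ω Ωs) : Type :=
  ∀ i : Fin 2, (M.elems i → RT0) × (M.elems i → P0)

/-- `𝒬_h = M_{1,h} × M_{2,h} × M_{J,1,h} × M_{J,2,h} × M_{λ,h}`: functions that are constant on every
face of `ℱ_{h,i}` (the hybrid variables), of `ℱ_{h,Γ,i}` (the interface fluxes) and of `ℱ_{h,Γ}` (the
remaining multiplier). -/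
abbrev Qh (M : Mesh Ω Ωs) : Type :=
  (∀ i : Fin 2, M.faces i → P0) × (∀ i : Fin 2, M.interfaceFacesOf i → P0) ×
    (M.interfaceFaces → P0)

/-- The flux in the subregion `i`, on the element `K`. -/
def Vh.flux {M : Mesh Ω Ωs} (v : M.Vh) (i : Fin 2) (K : M.elems i) : E3 → E3 := (v i).1 K

/-- The primal variable in the subregion `i`, on the element `K`. -/
def Vh.primal {M : Mesh Ω Ωs} (v : M.Vh) (i : Fin 2) (K : M.elems i) : E3 → ℝ := (v i).2 K

/-- The hybrid variable `û_i` (or `μ_i`) on a face of `ℱ_{h,i}`. -/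
def Qh.hybrid {M : Mesh Ω Ωs} (q : M.Qh) (i : Fin 2) (F : M.faces i) : E3 → ℝ := q.1 i F

/-- The interface flux `𝒥_i` (or `ρ_i`) on a face of `ℱ_{h,Γ,i}`. -/
def Qh.interfaceFlux {M : Mesh Ω Ωs} (q : M.Qh) (i : Fin 2) (F : M.interfaceFacesOf i) : E3 → ℝ :=
  q.2.1 i F

/-- The multiplier `λ` (or `φ`) on a face of `ℱ_{h,Γ}`. -/
def Qh.multiplier {M : Mesh Ω Ωs} (q : M.Qh) (F : M.interfaceFaces) : E3 → ℝ := q.2.2 F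

/-- A face of `ℱ_{h,Σ_i}` as a face of `ℱ_{h,i}`. -/
def bdFace (M : Mesh Ω Ωs) {i : Fin 2} (F : M.boundaryFaces i) : M.faces i :=
  ⟨F, M.boundaryFaces_subset i F.2⟩

/-- A face of `ℱ_{h,Γ,i}` as a face of `ℱ_{h,i}`. -/
def ifFace (M : Mesh Ω Ωs) {i : Fin 2} (F : M.interfaceFacesOf i) : M.faces i :=
  ⟨F, M.interfaceFacesOf_subset i F.2⟩

/-- A face of `ℱ_{h,Γ}` as a face of `ℱ_{h,Γ,i}`. -/
def ifFaceOf (M : Mesh Ω Ωs) (i : Fin 2) (F : M.interfaceFaces) : M.interfaceFacesOf i :=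
  ⟨F, (M.interfaceFacesOf_eq i).symm ▸ F.2⟩

/-- A face of `ℱ_{h,Γ,i}` as a face of `ℱ_{h,Γ}`. -/
def ofIfFace (M : Mesh Ω Ωs) {i : Fin 2} (F : M.interfaceFacesOf i) : M.interfaceFaces :=
  ⟨F, M.interfaceFacesOf_eq i ▸ F.2⟩

/-- The bilinear form `a(u, v)`; every integral over `Ω_i` is the sum of the integrals over the
elements of `𝒯_{h,i}`. -/
noncomputable def formA (M : Mesh Ω Ωs) (d : Data) (u v : M.Vh) : ℝ :=
  ∑ i : Fin 2,
    ((∑ K : M.elems i, ∫ x in hull K, inner ℝ ((d.mu x)⁻¹ • u.flux i K x) (v.flux i K x))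
      - (∑ K : M.elems i, ∫ x in hull K,
          inner ℝ ((d.mu x)⁻¹ • u.primal i K x • d.vel x) (v.flux i K x))
      + (∑ K : M.elems i, ∫ x in hull K, d.r x * u.primal i K x * v.primal i K x)
      - (∑ K : M.elems i, ∫ x in hull K, u.primal i K x * divergence (v.flux i K) x)
      + (∑ K : M.elems i, ∫ x in hull K, v.primal i K x * divergence (u.flux i K) x))

/-- The bilinear form `b(u, q) = ∑_i ∑_{K ∈ 𝒯_{h,i}} (J_i · n_{∂K}, μ_i)_{∂K}`; the boundary of `K`
consists of the four faces opposite to its vertices `P`. -/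
noncomputable def formB (M : Mesh Ω Ωs) (u : M.Vh) (q : M.Qh) : ℝ :=
  ∑ i : Fin 2, ∑ K : M.elems i, ∑ P : (K : Finset E3),
    ∫ x in hull (oppFace K P),
      inner ℝ (u.flux i K x) (outwardNormal K P) *
        q.hybrid i ⟨oppFace K P, M.oppFace_mem K.2 P.2⟩ x ∂area

/-- The bilinear form `c(p, q)`. -/
noncomputable def formC (M : Mesh Ω Ωs) (d : Data) (p q : M.Qh) : ℝ :=
  ∑ i : Fin 2,
    ((∑ F : M.boundaryFaces i, ∫ x in hull F,
        d.alpha x * p.hybrid i (M.bdFace F) x * q.hybrid i (M.bdFace F) x ∂area)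
      - (∑ F : M.interfaceFacesOf i, ∫ x in hull F,
          q.interfaceFlux i F x * p.hybrid i (M.ifFace F) x ∂area)
      + (∑ F : M.interfaceFacesOf i, ∫ x in hull F,
          q.interfaceFlux i F x * (d.seg i * p.multiplier (M.ofIfFace F) x) ∂area)
      + (∑ F : M.interfaceFacesOf i, ∫ x in hull F,
          p.interfaceFlux i F x * q.hybrid i (M.ifFace F) x ∂area)
      - (∑ F : M.interfaceFaces, ∫ x in hull F,
          p.interfaceFlux i (M.ifFaceOf i F) x * q.multiplier F x ∂area))

/-- The linear functional `F(v) = (g, φ₁)₁ + (g, φ₂)₂`. -/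
noncomputable def rhsF (M : Mesh Ω Ωs) (d : Data) (v : M.Vh) : ℝ :=
  ∑ i : Fin 2, ∑ K : M.elems i, ∫ x in hull K, d.g x * v.primal i K x

/-- The linear functional `G(q) = - ∑_i (β, μ_i)_{Σ_i} - (σ, φ)_Γ`. -/
noncomputable def rhsG (M : Mesh Ω Ωs) (d : Data) (q : M.Qh) : ℝ :=
  -(∑ i : Fin 2, ∑ F : M.boundaryFaces i, ∫ x in hull F,
      d.beta x * q.hybrid i (M.bdFace F) x ∂area)
    - ∑ F : M.interfaceFaces, ∫ x in hull F, d.sigma x * q.multiplier F x ∂area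

/-- `(u, p) ∈ 𝒱_h × 𝒬_h` solves the DMH-RT0 discrete problem. -/
def IsSolution (M : Mesh Ω Ωs) (d : Data) (u : M.Vh) (p : M.Qh) : Prop :=
  (∀ v : M.Vh, M.formA d u v + M.formB v p = M.rhsF d v) ∧
    ∀ q : M.Qh, M.formB u q - M.formC d p q = M.rhsG d q

end Mesh

/-- The assumptions on the coefficients and data.  The norm `‖𝐯‖_{∞,Ω}` is the essential supremum
over `Ω` of the Euclidean norm of `𝐯`. -/
structure Data.Admissible (d : Data) (Ω : Set E3) (Ωs : Fin 2 → Set E3)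
    (muMin muMax rMin rMax : ℝ) : Prop where
  mu_meas : AEStronglyMeasurable d.mu (volume.restrict Ω)
  muMin_pos : 0 < muMin
  mu_bounds : ∀ᵐ x ∂volume.restrict Ω, muMin ≤ d.mu x ∧ d.mu x ≤ muMax
  r_meas : AEStronglyMeasurable d.r (volume.restrict Ω)
  rMin_pos : 0 < rMin
  r_bounds : ∀ᵐ x ∂volume.restrict Ω, rMin ≤ d.r x ∧ d.r x ≤ rMax
  g_mem : MemLp d.g 2 (volume.restrict Ω)
  vel_mem : MemLp d.vel ⊤ (volume.restrict Ω)
  vel_small : (eLpNorm d.vel ⊤ (volume.restrict Ω)).toReal < 2 * muMin * min muMax⁻¹ rMin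
  alpha_mem : MemLp d.alpha ⊤ (area.restrict (frontier Ω))
  alpha_pos : ∀ᵐ x ∂area.restrict (frontier Ω), 0 < d.alpha x
  beta_mem : MemLp d.beta 2 (area.restrict (frontier Ω))
  sigma_mem : MemLp d.sigma 2 (area.restrict (interface Ωs))
  kappa_pos : 0 < d.kappa

end DMH

/-! The problem is a square linear system on the finite-dimensional space `𝒱_h × 𝒬_h`, so it is
enough to show that the homogeneous problem has only the zero solution. Integrability of every
integrand, which follows from the bounds on the data and the finite measure of elements and faces,
makes the forms genuinely bilinear.

For a homogeneous solution `(u, p)`, the interface terms of `c` are skew only up to the factors `1`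
and `κ` in the transmission conditions. Weights `κ` on the first subregion and `1` on the second
repair this: their product with those factors is `κ` on both sides. Testing with the weighted `u`,
and with the weighted `p` whose multiplier is scaled by `κ`, cancels the `b` terms, the divergence
terms and all interface terms (`formA_scale`, `formB_weighted`, `formC_weighted`). What remains is a
sum of weighted element energies plus a nonnegative Robin term, equal to zero. By Young's inequality
and the smallness of the advection field the energies are coercive (`energy_lower_bound`), hence `u
= 0`.

The first equation is then `b(v, p) = 0` for all `v`. On a tetrahedron the field `x - P` has zero
normal component on the faces through `P` and a positive constant one on the opposite face, so a
field can be built element by element whose normal components are positive multiples of the hybrid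
unknowns; these vanish (`hybrid_eq_zero_of_formB_lift`). The second equation is now `c(p, q) = 0`,
and the choice `μ_i = 𝒥_i`, `ρ_i = κ_i λ`, `φ = 0` turns it into a vanishing sum of squares
(`eq_zero_of_formC_interfaceTest`), so `p = 0`. -/

namespace DMH

/-! ### Surface area of faces -/

/-- A convex compact set spanning a plane has positive finite area. -/
theorem area_pos_lt_top {s : Set E3} (hne : s.Nonempty) (hc : Convex ℝ s) (hk : IsCompact s)
    (hdim : Module.finrank ℝ (vectorSpan ℝ s) = 2) : 0 < area s ∧ area s < ⊤ := by
  obtain ⟨p, hp⟩ := hne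
  have hpA : p ∈ affineSpan ℝ s := subset_affineSpan ℝ s hp
  let p' : affineSpan ℝ s := ⟨p, hpA⟩
  have : Nonempty (affineSpan ℝ s) := ⟨p'⟩
  have hdim' : Module.finrank ℝ (affineSpan ℝ s).direction = 2 := by
    rw [direction_affineSpan]; exact hdim
  set t : Set (affineSpan ℝ s) := (↑) ⁻¹' s with ht
  have himg : ((↑) : affineSpan ℝ s → E3) '' t = s := by
    exact Set.image_preimage_eq_of_subset
      (Subtype.range_coe.symm ▸ subset_affineSpan ℝ s)
  have harea : area s = μHE[2] t := by
    conv_lhs => rw [← himg]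
    exact AffineSubspace.euclideanHausdorffMeasure_coe_image 2 _ _
  -- A nonempty convex set has interior points relative to its affine span; this yields positivity
  -- of the area.
  have hint : (interior t).Nonempty := by
    have h := (Set.Nonempty.intrinsicInterior hc ⟨p, hp⟩)
    rw [intrinsicInterior] at h
    exact Set.image_nonempty.1 h
  have htk : IsCompact t :=
    (AffineSubspace.closed_of_finiteDimensional (affineSpan ℝ s)).isClosedEmbedding_subtypeVal.isCompact_preimage hk
  -- The base point `p'` identifies the plane isometrically with its direction, where the area
  -- becomes Lebesgue measure.
  have hm := EuclideanGeometry.euclideanHausdorffMeasure_eq (V := (affineSpan ℝ s).direction) p'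
  rw [hdim'] at hm
  have hmeas : ∀ A : Set (affineSpan ℝ s), μHE[2] A =
      volume ((IsometryEquiv.vaddConst p') ⁻¹' A) := by
    intro A
    rw [hm]
    exact (IsometryEquiv.vaddConst p').toHomeomorph.toMeasurableEquiv.map_apply A
  rw [harea, hmeas]
  constructor
  · refine lt_of_lt_of_le ?_ (measure_mono (Set.preimage_mono interior_subset))
    refine (isOpen_interior.preimage (IsometryEquiv.vaddConst p').continuous).measure_pos _ ?_
    exact hint.preimage (IsometryEquiv.vaddConst p').surjective
  · exact ((IsometryEquiv.vaddConst p').toHomeomorph.isCompact_preimage.2 htk).measure_lt_top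

theorem isCompact_hull (S : Finset E3) : IsCompact (hull S) :=
  S.finite_toSet.isCompact_convexHull ℝ

theorem hull_subset_affineSpan (S : Finset E3) : hull S ⊆ affineSpan ℝ (S : Set E3) :=
  convexHull_subset_affineSpan _

/-! ### Normals and heights of a tetrahedron -/

section Tetrahedron

variable {K : Finset E3} {P Q : E3}

theorem area_hull_oppFace (hK : K.card = 4) (hind : AffineIndependent ℝ ((↑) : K → E3))
    (hP : P ∈ K) : 0 < area (hull (oppFace K P)) ∧ area (hull (oppFace K P)) < ⊤ := by
  classical
  have hcard : (oppFace K P).card = 3 := by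
    rw [oppFace, Finset.card_erase_of_mem hP, hK]
  have hne : (oppFace K P).Nonempty := Finset.card_pos.1 (by omega)
  have hind' : AffineIndependent ℝ ((↑) : oppFace K P → E3) :=
    hind.mono (Finset.coe_subset.2 (Finset.erase_subset _ _))
  refine area_pos_lt_top ((Finset.coe_nonempty.2 hne).convexHull) (convex_convexHull ℝ _)
    (isCompact_hull _) ?_
  have h := hind'.finrank_vectorSpan (n := 2) (by simp [hcard])
  have hspan : vectorSpan ℝ (hull (oppFace K P)) =
      vectorSpan ℝ (Set.range ((↑) : oppFace K P → E3)) := by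
    rw [← direction_affineSpan, affineSpan_convexHull, direction_affineSpan, Subtype.range_coe]
  rw [hspan, h]

theorem inner_normalDir_of_mem_vectorSpan {y : E3}
    (hy : y ∈ vectorSpan ℝ (oppFace K P : Set E3)) : inner ℝ y (normalDir K P) = 0 :=
  Submodule.inner_right_of_mem_orthogonal hy (Submodule.starProjection_apply_mem _ _)

theorem sub_mem_vectorSpan_oppFace {x y : E3} (hx : x ∈ hull (oppFace K P))
    (hy : y ∈ hull (oppFace K P)) : x - y ∈ vectorSpan ℝ (oppFace K P : Set E3) := by
  rw [← direction_affineSpan]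
  exact AffineSubspace.vsub_mem_direction (hull_subset_affineSpan _ hx)
    (hull_subset_affineSpan _ hy)

theorem inner_sub_normalDir_of_ne (hP : P ∈ K) (hPQ : P ≠ Q) {x : E3}
    (hx : x ∈ hull (oppFace K Q)) : inner ℝ (x - P) (normalDir K Q) = 0 := by
  classical
  exact inner_normalDir_of_mem_vectorSpan
    (sub_mem_vectorSpan_oppFace hx (subset_convexHull ℝ _ (Finset.mem_erase.2 ⟨hPQ, hP⟩)))

/-- Replacing `x` by the centroid changes `x - P` only within the face plane, and the orthogonal
projection is self-adjoint and idempotent. Thus `‖normalDir K P‖` is the height of the tetrahedron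
over that face. -/
theorem inner_sub_normalDir_self (hne : (oppFace K P).Nonempty) {x : E3}
    (hx : x ∈ hull (oppFace K P)) :
    inner ℝ (x - P) (normalDir K P) = ‖normalDir K P‖ ^ 2 := by
  have hc := Finset.centroid_mem_convexHull (R := ℝ) (oppFace K P) hne
  have h1 := inner_normalDir_of_mem_vectorSpan (sub_mem_vectorSpan_oppFace hx hc)
  have h2 : inner ℝ ((oppFace K P).centroid ℝ id - P) (normalDir K P) = ‖normalDir K P‖ ^ 2 := by
    rw [← real_inner_self_eq_norm_sq, normalDir, Submodule.inner_starProjection_left_eq_right,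
      Submodule.starProjection_eq_self_iff.2 (Submodule.starProjection_apply_mem _ _)]
  rw [← h2, ← sub_eq_zero, ← inner_sub_left, sub_sub_sub_cancel_right, h1]

/-- A zero height would put `P` in the plane of the opposite face, against affine independence of
the vertices. -/
theorem normalDir_ne_zero (hind : AffineIndependent ℝ ((↑) : K → E3))
    (hP : P ∈ K) (hne : (oppFace K P).Nonempty) : normalDir K P ≠ 0 := by
  classical
  intro h
  rw [normalDir, Submodule.starProjection_apply_eq_zero_iff, Submodule.orthogonal_orthogonal,
    ← direction_affineSpan] at h
  have hc := hull_subset_affineSpan _ (Finset.centroid_mem_convexHull (R := ℝ) (oppFace K P) hne)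
  have hPm : P ∈ affineSpan ℝ (oppFace K P : Set E3) := by
    have := AffineSubspace.vadd_mem_of_mem_direction (neg_mem h) hc
    simpa using this
  have := hind.notMem_affineSpan_sdiff ⟨P, hP⟩ Set.univ
  apply this
  convert hPm using 2
  ext x
  simp [oppFace, and_comm]

theorem inner_sub_outwardNormal_of_ne (hP : P ∈ K) (hPQ : P ≠ Q) {x : E3}
    (hx : x ∈ hull (oppFace K Q)) : inner ℝ (x - P) (outwardNormal K Q) = 0 := by
  rw [outwardNormal, inner_smul_right, inner_sub_normalDir_of_ne hP hPQ hx, mul_zero]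

theorem inner_sub_outwardNormal_self (hne : (oppFace K P).Nonempty) {x : E3}
    (hx : x ∈ hull (oppFace K P)) :
    inner ℝ (x - P) (outwardNormal K P) = ‖normalDir K P‖ := by
  rw [outwardNormal, inner_smul_right, inner_sub_normalDir_self hne hx, pow_two]
  by_cases h : ‖normalDir K P‖ = 0
  · simp [h]
  · field_simp

theorem interior_hull_nonempty (hK : K.card = 4) (hind : AffineIndependent ℝ ((↑) : K → E3)) :
    (interior (hull K)).Nonempty := by
  rw [hull, interior_convexHull_nonempty_iff_affineSpan_eq_top]
  have h := hind.affineSpan_eq_top_iff_card_eq_finrank_add_one.2 (by simp [hK])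
  rwa [Subtype.range_coe] at h

end Tetrahedron

/-! ### Elements and faces inside the domain -/

namespace Mesh

variable {Ω : Set E3} {Ωs : Fin 2 → Set E3}

theorem interior_hull_subset (hΩ : IsInterfaceDomain Ω Ωs) (M : Mesh Ω Ωs) {i : Fin 2}
    {K : Finset E3} (hK : K ∈ M.elems i) : interior (hull K) ⊆ Ω := by
  have h1 : hull K ⊆ closure (Ωs i) := by
    rw [M.cover i]
    exact Set.subset_biUnion_of_mem (u := fun K : Finset E3 => convexHull ℝ (K : Set E3)) hK
  rw [hΩ.eq_interior]
  refine interior_mono (h1.trans ?_)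
  fin_cases i
  · exact Set.subset_union_left
  · exact Set.subset_union_right

/-- A closed element may touch `∂Ω`, but its interior lies in `Ω` and the frontier of a convex set
is Lebesgue-null. Almost-everywhere bounds on `Ω` therefore pass to each element. -/
theorem restrict_hull_le (hΩ : IsInterfaceDomain Ω Ωs) (M : Mesh Ω Ωs) {i : Fin 2}
    {K : Finset E3} (hK : K ∈ M.elems i) :
    volume.restrict (hull K) ≤ volume.restrict Ω := by
  rw [← Measure.restrict_congr_set
    (interior_ae_eq_of_null_frontier ((convex_convexHull ℝ (K : Set E3)).addHaar_frontier volume))]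
  exact Measure.restrict_mono (M.interior_hull_subset hΩ hK) le_rfl

theorem exists_oppFace_of_mem_faces (M : Mesh Ω Ωs) {i : Fin 2} {F : Finset E3}
    (hF : F ∈ M.faces i) : ∃ K ∈ M.elems i, ∃ P ∈ K, oppFace K P = F := by
  classical
  obtain ⟨K, hK, h⟩ := Finset.mem_biUnion.1 hF
  obtain ⟨P, hP, h⟩ := Finset.mem_image.1 h
  exact ⟨K, hK, P, hP, h⟩

theorem area_hull_face (M : Mesh Ω Ωs) {i : Fin 2} {F : Finset E3} (hF : F ∈ M.faces i) :
    0 < area (hull F) ∧ area (hull F) < ⊤ := by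
  obtain ⟨K, hK, P, hP, rfl⟩ := M.exists_oppFace_of_mem_faces hF
  exact area_hull_oppFace (M.card_eq i K hK) (M.affineIndep i K hK) hP

end Mesh

/-! ### Bilinear functions and finite-dimensional solvability -/

section Bilinear

variable {V W X : Type*} [AddCommGroup V] [Module ℝ V] [AddCommGroup W] [Module ℝ W]

/-- A function of two variables that is linear in each of them. -/
def IsBilin (f : V → W → ℝ) : Prop :=
  (∀ w, IsLinearMap ℝ fun v => f v w) ∧ ∀ v, IsLinearMap ℝ (f v)

theorem isLinearMap_finsetSum {ι : Type*} {s : Finset ι} {f : ι → V → ℝ}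
    (h : ∀ i ∈ s, IsLinearMap ℝ (f i)) : IsLinearMap ℝ fun v => ∑ i ∈ s, f i v := by
  constructor
  · intro v v'
    rw [← Finset.sum_add_distrib]
    exact Finset.sum_congr rfl fun i hi => (h i hi).map_add v v'
  · intro c v
    rw [smul_eq_mul, Finset.mul_sum]
    exact Finset.sum_congr rfl fun i hi => (h i hi).map_smul c v

/-- Integrability is required for every `v`: a nonintegrable function has integral `0` by
convention, which could break additivity. -/
theorem isLinearMap_integral [MeasurableSpace X] {m : Measure X} {f : X → V → ℝ}
    (h : ∀ x, IsLinearMap ℝ (f x)) (hf : ∀ v, Integrable (fun x => f x v) m) :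
    IsLinearMap ℝ fun v => ∫ x, f x v ∂m := by
  constructor
  · intro v v'
    rw [← integral_add (hf v) (hf v')]
    exact integral_congr_ae (Filter.Eventually.of_forall fun x => (h x).map_add v v')
  · intro c v
    rw [smul_eq_mul, ← integral_const_mul]
    exact integral_congr_ae (Filter.Eventually.of_forall fun x => (h x).map_smul c v)

theorem isLinearMap_add {f g : V → ℝ} (hf : IsLinearMap ℝ f) (hg : IsLinearMap ℝ g) :
    IsLinearMap ℝ fun v => f v + g v :=
  (hf.mk' f + hg.mk' g).isLinear

theorem isLinearMap_neg {f : V → ℝ} (hf : IsLinearMap ℝ f) : IsLinearMap ℝ fun v => -f v :=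
  (-hf.mk' f).isLinear

theorem isLinearMap_sub {f g : V → ℝ} (hf : IsLinearMap ℝ f) (hg : IsLinearMap ℝ g) :
    IsLinearMap ℝ fun v => f v - g v :=
  (hf.mk' f - hg.mk' g).isLinear

namespace IsBilin

variable {f g : V → W → ℝ}

theorem add (hf : IsBilin f) (hg : IsBilin g) : IsBilin fun v w => f v w + g v w :=
  ⟨fun w => isLinearMap_add (hf.1 w) (hg.1 w), fun v => isLinearMap_add (hf.2 v) (hg.2 v)⟩

theorem sub (hf : IsBilin f) (hg : IsBilin g) : IsBilin fun v w => f v w - g v w :=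
  ⟨fun w => isLinearMap_sub (hf.1 w) (hg.1 w), fun v => isLinearMap_sub (hf.2 v) (hg.2 v)⟩

theorem sum {ι : Type*} {s : Finset ι} {f : ι → V → W → ℝ} (h : ∀ i ∈ s, IsBilin (f i)) :
    IsBilin fun v w => ∑ i ∈ s, f i v w :=
  ⟨fun w => isLinearMap_finsetSum fun i hi => (h i hi).1 w,
    fun v => isLinearMap_finsetSum fun i hi => (h i hi).2 v⟩

theorem integral [MeasurableSpace X] {m : Measure X} {f : X → V → W → ℝ}
    (h : ∀ x, IsBilin (f x)) (hf : ∀ v w, Integrable (fun x => f x v w) m) :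
    IsBilin fun v w => ∫ x, f x v w ∂m :=
  ⟨fun w => isLinearMap_integral (fun x => (h x).1 w) fun v => hf v w,
    fun v => isLinearMap_integral (fun x => (h x).2 v) fun w => hf v w⟩

theorem mul {f : V → ℝ} {g : W → ℝ} (hf : IsLinearMap ℝ f) (hg : IsLinearMap ℝ g) :
    IsBilin fun v w => f v * g w := by
  refine ⟨fun w => ⟨fun v v' => ?_, fun c v => ?_⟩, fun v => ⟨fun w w' => ?_, fun c w => ?_⟩⟩
  · beta_reduce; rw [hf.map_add, add_mul]
  · beta_reduce; rw [hf.map_smul, smul_eq_mul, smul_eq_mul, mul_assoc]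
  · beta_reduce; rw [hg.map_add, mul_add]
  · beta_reduce; rw [hg.map_smul, smul_eq_mul, smul_eq_mul, mul_left_comm]

theorem innerProd {f : V → E3} {g : W → E3} (hf : IsLinearMap ℝ f) (hg : IsLinearMap ℝ g) :
    IsBilin fun v w => inner ℝ (f v) (g w) := by
  refine ⟨fun w => ⟨fun v v' => ?_, fun c v => ?_⟩, fun v => ⟨fun w w' => ?_, fun c w => ?_⟩⟩
  · beta_reduce; rw [hf.map_add, inner_add_left]
  · beta_reduce; rw [hf.map_smul, real_inner_smul_left, smul_eq_mul]
  · beta_reduce; rw [hg.map_add, inner_add_right]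
  · beta_reduce; rw [hg.map_smul, real_inner_smul_right, smul_eq_mul]

theorem swap (hf : IsBilin f) : IsBilin fun w v => f v w := ⟨hf.2, hf.1⟩

theorem compLeft {U : Type*} [AddCommGroup U] [Module ℝ U] (hf : IsBilin f) (φ : U →ₗ[ℝ] V) :
    IsBilin fun u w => f (φ u) w :=
  ⟨fun w => ((hf.1 w).mk' _ ∘ₗ φ).isLinear, fun u => hf.2 (φ u)⟩

theorem compRight {U : Type*} [AddCommGroup U] [Module ℝ U] (hf : IsBilin f) (φ : U →ₗ[ℝ] W) :
    IsBilin fun v u => f v (φ u) :=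
  ⟨fun u => hf.1 (φ u), fun v => ((hf.2 v).mk' _ ∘ₗ φ).isLinear⟩

/-- In a finite-dimensional space, a variational problem with bilinear form `f` is uniquely solvable
if the homogeneous problem has only the zero solution. -/
theorem existsUnique_of_forall_eq_zero [FiniteDimensional ℝ V] {f : V → V → ℝ} (hf : IsBilin f)
    (h0 : ∀ u, (∀ v, f u v = 0) → u = 0) {g : V → ℝ} (hg : IsLinearMap ℝ g) :
    ∃! u, ∀ v, f u v = g v := by
  let B : V →ₗ[ℝ] Module.Dual ℝ V := LinearMap.mk₂ ℝ f (fun u u' v => (hf.1 v).map_add u u')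
    (fun c u v => (hf.1 v).map_smul c u) (fun u v v' => (hf.2 u).map_add v v')
    (fun c u v => (hf.2 u).map_smul c v)
  have hinj : Function.Injective B := by
    rw [← LinearMap.ker_eq_bot, LinearMap.ker_eq_bot']
    exact fun u hu => h0 u fun v => LinearMap.congr_fun hu v
  -- A space and its dual have equal dimension, so injectivity forces surjectivity.
  have hsurj : Function.Surjective B :=
    (LinearMap.injective_iff_surjective_of_finrank_eq_finrank
      (Subspace.dual_finrank_eq (K := ℝ) (V := V)).symm).1 hinj
  obtain ⟨u, hu⟩ := hsurj (hg.mk' g)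
  refine ⟨u, fun v => LinearMap.congr_fun hu v, fun u' hu' => hinj ?_⟩
  rw [hu]
  exact LinearMap.ext hu'

end IsBilin

end Bilinear

/-! ### The local polynomial spaces -/

section Polynomials

theorem RT0.exists_eq (τ : RT0) : ∃ (a : E3) (b : ℝ), (τ : E3 → E3) = fun x => a + b • x := by
  obtain ⟨a, b, h⟩ := τ.2
  exact ⟨a, b, funext h⟩

/-- The origin is the sample point for reading off the constant, even when it lies outside the
element or face concerned. -/
theorem P0.eq_const (φ : P0) : (φ : E3 → ℝ) = fun _ => (φ : E3 → ℝ) 0 := by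
  obtain ⟨c, h⟩ := φ.2
  funext x
  rw [h, h]

theorem RT0.continuous (τ : RT0) : Continuous (τ : E3 → E3) := by
  obtain ⟨a, b, h⟩ := RT0.exists_eq τ
  rw [h]
  fun_prop

theorem P0.continuous (φ : P0) : Continuous (φ : E3 → ℝ) := by
  rw [P0.eq_const]
  fun_prop

theorem RT0.differentiable (τ : RT0) : Differentiable ℝ (τ : E3 → E3) := by
  obtain ⟨a, b, h⟩ := RT0.exists_eq τ
  rw [h]
  fun_prop

theorem RT0.isLinearMap_divergence (x : E3) :
    IsLinearMap ℝ fun τ : RT0 => divergence (τ : E3 → E3) x := by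
  constructor
  · intro τ σ
    simp only [divergence, Submodule.coe_add]
    rw [fderiv_add (RT0.differentiable τ x) (RT0.differentiable σ x), ← Finset.sum_add_distrib]
    simp
  · intro c τ
    simp only [divergence, Submodule.coe_smul]
    rw [fderiv_const_smul (RT0.differentiable τ x), smul_eq_mul, Finset.mul_sum]
    simp

theorem RT0.continuous_divergence (τ : RT0) : Continuous (divergence (τ : E3 → E3)) := by
  obtain ⟨a, b, h⟩ := RT0.exists_eq τ
  have h' : divergence (τ : E3 → E3) = fun _ => ∑ j : Fin 3, b * EuclideanSpace.single j 1 j := by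
    funext x
    have hd : fderiv ℝ (fun x : E3 => a + b • x) x = b • ContinuousLinearMap.id ℝ E3 := by
      exact ((b • ContinuousLinearMap.id ℝ E3).hasFDerivAt.const_add a).fderiv
    simp [divergence, h, hd]
  rw [h']
  exact continuous_const

instance : FiniteDimensional ℝ RT0 := by
  let f : E3 × ℝ →ₗ[ℝ] RT0 :=
    { toFun := fun p => ⟨fun x => p.1 + p.2 • x, p.1, p.2, fun _ => rfl⟩
      map_add' := fun p q => Subtype.ext (funext fun x => by
        simp only [Prod.fst_add, Prod.snd_add, Submodule.coe_add, Pi.add_apply]; module)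
      map_smul' := fun c p => Subtype.ext (funext fun x => by
        simp only [Prod.smul_fst, Prod.smul_snd, Submodule.coe_smul, Pi.smul_apply,
          RingHom.id_apply, smul_eq_mul]; module) }
  refine Module.Finite.of_surjective f fun τ => ?_
  obtain ⟨a, b, h⟩ := RT0.exists_eq τ
  exact ⟨(a, b), Subtype.ext h.symm⟩

/-- A real number as a constant function. -/
def P0.const : ℝ →ₗ[ℝ] P0 where
  toFun c := ⟨fun _ => c, c, fun _ => rfl⟩
  map_add' _ _ := rfl
  map_smul' _ _ := rfl

theorem P0.const_surjective : Function.Surjective P0.const := fun φ =>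
  ⟨(φ : E3 → ℝ) 0, Subtype.ext (P0.eq_const φ).symm⟩

instance : FiniteDimensional ℝ P0 := Module.Finite.of_surjective P0.const P0.const_surjective

end Polynomials

namespace Mesh

variable {Ω : Set E3} {Ωs : Fin 2 → Set E3} (M : Mesh Ω Ωs)

theorem Vh.isLinearMap_flux (i : Fin 2) (K : M.elems i) (x : E3) :
    IsLinearMap ℝ fun v : M.Vh => v.flux i K x := ⟨fun _ _ => rfl, fun _ _ => rfl⟩

theorem Vh.isLinearMap_primal (i : Fin 2) (K : M.elems i) (x : E3) :
    IsLinearMap ℝ fun v : M.Vh => v.primal i K x := ⟨fun _ _ => rfl, fun _ _ => rfl⟩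

theorem Vh.isLinearMap_divergence_flux (i : Fin 2) (K : M.elems i) (x : E3) :
    IsLinearMap ℝ fun v : M.Vh => divergence (v.flux i K) x :=
  ⟨fun u v => (RT0.isLinearMap_divergence x).map_add ((u i).1 K) ((v i).1 K),
    fun c v => (RT0.isLinearMap_divergence x).map_smul c ((v i).1 K)⟩

theorem Qh.isLinearMap_hybrid (i : Fin 2) (F : M.faces i) (x : E3) :
    IsLinearMap ℝ fun q : M.Qh => q.hybrid i F x := ⟨fun _ _ => rfl, fun _ _ => rfl⟩

theorem Qh.isLinearMap_interfaceFlux (i : Fin 2) (F : M.interfaceFacesOf i) (x : E3) :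
    IsLinearMap ℝ fun q : M.Qh => q.interfaceFlux i F x := ⟨fun _ _ => rfl, fun _ _ => rfl⟩

theorem Qh.isLinearMap_multiplier (F : M.interfaceFaces) (x : E3) :
    IsLinearMap ℝ fun q : M.Qh => q.multiplier F x := ⟨fun _ _ => rfl, fun _ _ => rfl⟩

end Mesh

theorem isLinearMap_const_mul {V : Type*} [AddCommGroup V] [Module ℝ V] (c : ℝ) {f : V → ℝ}
    (hf : IsLinearMap ℝ f) : IsLinearMap ℝ fun v => c * f v :=
  (c • hf.mk' f).isLinear

theorem isLinearMap_const_smul {V : Type*} [AddCommGroup V] [Module ℝ V] (c : ℝ) {f : V → E3}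
    (hf : IsLinearMap ℝ f) : IsLinearMap ℝ fun v => c • f v :=
  (c • hf.mk' f).isLinear

theorem isLinearMap_smul_const {V : Type*} [AddCommGroup V] [Module ℝ V] (y : E3) {f : V → ℝ}
    (hf : IsLinearMap ℝ f) : IsLinearMap ℝ fun v => f v • y :=
  (LinearMap.smulRight (hf.mk' f) y).isLinear

/-! ### Integrability of the coefficients -/

section Integrability

variable {d : Data} {Ω : Set E3} {Ωs : Fin 2 → Set E3} {muMin muMax rMin rMax : ℝ}

theorem isFiniteMeasure_restrict_hull (K : Finset E3) :
    IsFiniteMeasure (volume.restrict (hull K)) :=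
  isFiniteMeasure_restrict.2 (isCompact_hull K).measure_lt_top.ne

theorem integrableOn_mul_of_continuous {m : Measure E3} {K : Finset E3} {f h : E3 → ℝ}
    (hf : IntegrableOn f (hull K) m) (hh : Continuous h) :
    IntegrableOn (fun x => f x * h x) (hull K) m :=
  hf.mul_continuousOn hh.continuousOn (isCompact_hull K)

/-- Finiteness of `m (hull K)` is assumed because compactness does not supply it: surface area is
not locally finite on `ℝ³`. -/
theorem integrableOn_hull_of_continuous {m : Measure E3} {K : Finset E3} (hm : m (hull K) < ⊤)
    {h : E3 → ℝ} (hh : Continuous h) : IntegrableOn h (hull K) m := by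
  have h1 : IntegrableOn (fun _ : E3 => (1 : ℝ)) (hull K) m := integrableOn_const hm.ne
  simpa using integrableOn_mul_of_continuous h1 hh

theorem integrableOn_inner_of_continuous {m : Measure E3} {K : Finset E3} {f h : E3 → E3}
    (hf : IntegrableOn f (hull K) m) (hh : Continuous h) :
    IntegrableOn (fun x => inner ℝ (f x) (h x)) (hull K) m := by
  refine Integrable.mono' (integrableOn_mul_of_continuous hf.norm hh.norm)
    (hf.aestronglyMeasurable.inner hh.aestronglyMeasurable) ?_
  exact Filter.Eventually.of_forall fun x => norm_inner_le_norm _ _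

namespace Data.Admissible

theorem memLp_inv_mu (hd : d.Admissible Ω Ωs muMin muMax rMin rMax) :
    MemLp (fun x => (d.mu x)⁻¹) ⊤ (volume.restrict Ω) := by
  refine memLp_top_of_bound hd.mu_meas.aemeasurable.inv.aestronglyMeasurable muMin⁻¹ ?_
  filter_upwards [hd.mu_bounds] with x hx
  have hpos := hd.muMin_pos
  rw [Real.norm_of_nonneg (inv_nonneg.2 (hpos.le.trans hx.1))]
  exact inv_anti₀ hpos hx.1

theorem memLp_r (hd : d.Admissible Ω Ωs muMin muMax rMin rMax) :
    MemLp d.r ⊤ (volume.restrict Ω) := by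
  refine memLp_top_of_bound hd.r_meas rMax ?_
  filter_upwards [hd.r_bounds] with x hx
  rw [Real.norm_of_nonneg (hd.rMin_pos.le.trans hx.1)]
  exact hx.2

theorem memLp_inv_mu_smul_vel (hd : d.Admissible Ω Ωs muMin muMax rMin rMax) :
    MemLp (fun x => (d.mu x)⁻¹ • d.vel x) ⊤ (volume.restrict Ω) :=
  hd.vel_mem.smul hd.memLp_inv_mu

theorem ae_norm_vel_le (hd : d.Admissible Ω Ωs muMin muMax rMin rMax) :
    ∀ᵐ x ∂volume.restrict Ω, ‖d.vel x‖ ≤ (eLpNorm d.vel ⊤ (volume.restrict Ω)).toReal := by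
  filter_upwards [ae_le_eLpNormEssSup (f := d.vel) (μ := volume.restrict Ω)] with x hx
  rw [← eLpNorm_exponent_top] at hx
  -- Finiteness of the essential supremum is what allows passing to real numbers.
  simpa using ENNReal.toReal_mono hd.vel_mem.2.ne hx

end Data.Admissible

theorem integrableOn_hull_of_memLp {E : Type*} [NormedAddCommGroup E] {K : Finset E3}
    (hK : volume.restrict (hull K) ≤ volume.restrict Ω) {p : ENNReal} (hp : 1 ≤ p) {f : E3 → E}
    (hf : MemLp f p (volume.restrict Ω)) : IntegrableOn f (hull K) := by
  have := isFiniteMeasure_restrict_hull K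
  exact (hf.mono_measure hK).integrable hp

theorem integrableOn_face_of_memLp {S : Set E3} {F : Finset E3} (hF : hull F ⊆ S)
    (hfin : area (hull F) < ⊤) {p : ENNReal} (hp : 1 ≤ p) {f : E3 → ℝ}
    (hf : MemLp f p (area.restrict S)) : IntegrableOn f (hull F) area := by
  have : IsFiniteMeasure (area.restrict (hull F)) := isFiniteMeasure_restrict.2 hfin.ne
  exact (hf.mono_measure (Measure.restrict_mono hF le_rfl)).integrable hp

end Integrability

/-! ### Bilinearity of the discrete forms -/

namespace Mesh

variable {Ω : Set E3} {Ωs : Fin 2 → Set E3} {M : Mesh Ω Ωs} {d : Data}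
  {muMin muMax rMin rMax : ℝ}

theorem Vh.continuous_flux (v : M.Vh) (i : Fin 2) (K : M.elems i) : Continuous (v.flux i K) :=
  RT0.continuous _

theorem Vh.continuous_primal (v : M.Vh) (i : Fin 2) (K : M.elems i) : Continuous (v.primal i K) :=
  P0.continuous _

theorem Vh.continuous_divergence_flux (v : M.Vh) (i : Fin 2) (K : M.elems i) :
    Continuous (divergence (v.flux i K)) :=
  RT0.continuous_divergence _

theorem Qh.continuous_hybrid (q : M.Qh) (i : Fin 2) (F : M.faces i) : Continuous (q.hybrid i F) :=
  P0.continuous _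

theorem Qh.continuous_interfaceFlux (q : M.Qh) (i : Fin 2) (F : M.interfaceFacesOf i) :
    Continuous (q.interfaceFlux i F) :=
  P0.continuous _

theorem Qh.continuous_multiplier (q : M.Qh) (F : M.interfaceFaces) :
    Continuous (q.multiplier F) :=
  P0.continuous _

section Integrands

variable (hΩ : IsInterfaceDomain Ω Ωs) (hd : d.Admissible Ω Ωs muMin muMax rMin rMax)
  {i : Fin 2} (K : M.elems i)

include hΩ hd

theorem integrableOn_diffusion {τ σ : E3 → E3} (hτ : Continuous τ) (hσ : Continuous σ) :
    IntegrableOn (fun x => inner ℝ ((d.mu x)⁻¹ • τ x) (σ x)) (hull K) := by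
  simp only [real_inner_smul_left]
  exact integrableOn_mul_of_continuous
    (integrableOn_hull_of_memLp (M.restrict_hull_le hΩ K.2) le_top hd.memLp_inv_mu) (hτ.inner hσ)

theorem integrableOn_advection {φ : E3 → ℝ} {σ : E3 → E3} (hφ : Continuous φ)
    (hσ : Continuous σ) :
    IntegrableOn (fun x => inner ℝ ((d.mu x)⁻¹ • φ x • d.vel x) (σ x)) (hull K) := by
  -- The scalar `φ` is moved to the other side of the inner product, leaving the bounded field `μ⁻¹
  -- 𝐯` against the continuous field `φ σ`.
  have h := integrableOn_inner_of_continuous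
    (integrableOn_hull_of_memLp (M.restrict_hull_le hΩ K.2) le_top hd.memLp_inv_mu_smul_vel)
    (hφ.smul hσ)
  refine h.congr (Filter.Eventually.of_forall fun x => ?_)
  simp only [Pi.smul_apply', real_inner_smul_left, real_inner_smul_right]
  ring

theorem integrableOn_reaction {φ ψ : E3 → ℝ} (hφ : Continuous φ) (hψ : Continuous ψ) :
    IntegrableOn (fun x => d.r x * φ x * ψ x) (hull K) := by
  simp only [mul_assoc]
  exact integrableOn_mul_of_continuous
    (integrableOn_hull_of_memLp (M.restrict_hull_le hΩ K.2) le_top hd.memLp_r) (hφ.mul hψ)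

theorem isBilin_formA : IsBilin fun u v : M.Vh => M.formA d u v := by
  unfold formA
  refine IsBilin.sum fun i _ => ((((IsBilin.sum fun K _ => ?_).sub (IsBilin.sum fun K _ => ?_)).add
    (IsBilin.sum fun K _ => ?_)).sub (IsBilin.sum fun K _ => ?_)).add (IsBilin.sum fun K _ => ?_)
  · exact IsBilin.integral (fun x => IsBilin.innerProd
      (isLinearMap_const_smul _ (Vh.isLinearMap_flux M i K x)) (Vh.isLinearMap_flux M i K x))
      fun u v => integrableOn_diffusion hΩ hd K (u.continuous_flux i K) (v.continuous_flux i K)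
  · exact IsBilin.integral (fun x => IsBilin.innerProd (isLinearMap_const_smul _
      (isLinearMap_smul_const _ (Vh.isLinearMap_primal M i K x))) (Vh.isLinearMap_flux M i K x))
      fun u v => integrableOn_advection hΩ hd K (u.continuous_primal i K) (v.continuous_flux i K)
  · exact IsBilin.integral (fun x => IsBilin.mul
      (isLinearMap_const_mul _ (Vh.isLinearMap_primal M i K x)) (Vh.isLinearMap_primal M i K x))
      fun u v => integrableOn_reaction hΩ hd K (u.continuous_primal i K) (v.continuous_primal i K)
  · exact IsBilin.integral (fun x => IsBilin.mul
      (Vh.isLinearMap_primal M i K x) (Vh.isLinearMap_divergence_flux M i K x))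
      fun u v => integrableOn_hull_of_continuous (isCompact_hull _).measure_lt_top
        ((u.continuous_primal i K).mul (v.continuous_divergence_flux i K))
  · exact IsBilin.integral (fun x => (IsBilin.mul
      (Vh.isLinearMap_primal M i K x) (Vh.isLinearMap_divergence_flux M i K x)).swap)
      fun u v => integrableOn_hull_of_continuous (isCompact_hull _).measure_lt_top
        ((v.continuous_primal i K).mul (u.continuous_divergence_flux i K))

theorem isLinearMap_rhsF : IsLinearMap ℝ fun v : M.Vh => M.rhsF d v := by
  unfold rhsF
  exact isLinearMap_finsetSum fun i _ => isLinearMap_finsetSum fun K _ => isLinearMap_integral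
    (fun x => isLinearMap_const_mul _ (Vh.isLinearMap_primal M i K x))
    fun v => integrableOn_mul_of_continuous (integrableOn_hull_of_memLp
      (M.restrict_hull_le hΩ K.2) (by norm_num) hd.g_mem) (v.continuous_primal i K)

end Integrands

theorem isBilin_formB : IsBilin fun (u : M.Vh) (q : M.Qh) => M.formB u q := by
  unfold formB
  refine IsBilin.sum fun i _ => IsBilin.sum fun K _ => IsBilin.sum fun P _ => IsBilin.integral
    (fun x => IsBilin.mul (f := fun u : M.Vh => inner ℝ (u.flux i K x) (outwardNormal K P))
      ⟨fun u v => inner_add_left _ _ _, fun c u => real_inner_smul_left _ _ _⟩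
      (Qh.isLinearMap_hybrid M i _ x))
    fun u q => integrableOn_hull_of_continuous (M.area_hull_face (M.oppFace_mem K.2 P.2)).2
      (((u.continuous_flux i K).inner continuous_const).mul (q.continuous_hybrid i _))

section Faces

variable (hd : d.Admissible Ω Ωs muMin muMax rMin rMax)

include hd

theorem integrableOn_alpha {i : Fin 2} (F : M.boundaryFaces i) :
    IntegrableOn d.alpha (hull F) area := by
  classical
  exact integrableOn_face_of_memLp (Finset.mem_filter.1 F.2).2
    (M.area_hull_face (M.bdFace F).2).2 le_top hd.alpha_mem

theorem isBilin_formC : IsBilin fun p q : M.Qh => M.formC d p q := by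
  unfold formC
  refine IsBilin.sum fun i _ => ((((IsBilin.sum fun F _ => ?_).sub (IsBilin.sum fun F _ => ?_)).add
    (IsBilin.sum fun F _ => ?_)).add (IsBilin.sum fun F _ => ?_)).sub (IsBilin.sum fun F _ => ?_)
  · refine IsBilin.integral (fun x => IsBilin.mul
      (isLinearMap_const_mul _ (Qh.isLinearMap_hybrid M i _ x)) (Qh.isLinearMap_hybrid M i _ x))
      fun p q => ?_
    simp only [mul_assoc]
    exact integrableOn_mul_of_continuous (integrableOn_alpha hd F)
      ((p.continuous_hybrid i _).mul (q.continuous_hybrid i _))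
  · exact IsBilin.integral (fun x => (IsBilin.mul
      (Qh.isLinearMap_interfaceFlux M i F x) (Qh.isLinearMap_hybrid M i _ x)).swap)
      fun p q => integrableOn_hull_of_continuous (M.area_hull_face (M.ifFace F).2).2
        ((q.continuous_interfaceFlux i F).mul (p.continuous_hybrid i _))
  · exact IsBilin.integral (fun x => (IsBilin.mul (Qh.isLinearMap_interfaceFlux M i F x)
      (isLinearMap_const_mul _ (Qh.isLinearMap_multiplier M _ x))).swap)
      fun p q => integrableOn_hull_of_continuous (M.area_hull_face (M.ifFace F).2).2
        ((q.continuous_interfaceFlux i F).mul (continuous_const.mul (p.continuous_multiplier _)))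
  · exact IsBilin.integral (fun x => IsBilin.mul
      (Qh.isLinearMap_interfaceFlux M i F x) (Qh.isLinearMap_hybrid M i _ x))
      fun p q => integrableOn_hull_of_continuous (M.area_hull_face (M.ifFace F).2).2
        ((p.continuous_interfaceFlux i F).mul (q.continuous_hybrid i _))
  · exact IsBilin.integral (fun x => IsBilin.mul
      (Qh.isLinearMap_interfaceFlux M i _ x) (Qh.isLinearMap_multiplier M F x))
      fun p q => integrableOn_hull_of_continuous
        (M.area_hull_face (M.ifFace (M.ifFaceOf i F)).2).2
        ((p.continuous_interfaceFlux i _).mul (q.continuous_multiplier F))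

theorem isLinearMap_rhsG : IsLinearMap ℝ fun q : M.Qh => M.rhsG d q := by
  classical
  unfold rhsG
  refine isLinearMap_sub (isLinearMap_neg ?_) ?_
  · exact isLinearMap_finsetSum fun i _ => isLinearMap_finsetSum fun F _ => isLinearMap_integral
      (fun x => isLinearMap_const_mul _ (Qh.isLinearMap_hybrid M i _ x))
      fun q => integrableOn_mul_of_continuous (integrableOn_face_of_memLp
        (Finset.mem_filter.1 F.2).2 (M.area_hull_face (M.bdFace F).2).2 (by norm_num) hd.beta_mem)
        (q.continuous_hybrid i _)
  · exact isLinearMap_finsetSum fun F _ => isLinearMap_integral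
      (fun x => isLinearMap_const_mul _ (Qh.isLinearMap_multiplier M F x))
      fun q => integrableOn_mul_of_continuous (integrableOn_face_of_memLp
        (Finset.mem_filter.1 F.2).2 (M.area_hull_face (M.ifFace (M.ifFaceOf 0 F)).2).2
        (by norm_num) hd.sigma_mem) (q.continuous_multiplier F)

end Faces

end Mesh

/-! ### Coercivity -/

/-- Coercivity of the local energy: the advection term is absorbed by diffusion and reaction. -/
theorem energy_lower_bound {m r V muMin muMax rMin u : ℝ} {w j : E3} (hmin : 0 < muMin)
    (h1 : muMin ≤ m) (h2 : m ≤ muMax) (hr : rMin ≤ r) (hw : ‖w‖ ≤ V) :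
    (min muMax⁻¹ rMin - V / (2 * muMin)) * (‖j‖ ^ 2 + u ^ 2) ≤
      inner ℝ (m⁻¹ • j) j - inner ℝ (m⁻¹ • u • w) j + r * u * u := by
  have hm : 0 < m := hmin.trans_le h1
  have hV : 0 ≤ V := (norm_nonneg w).trans hw
  have ha : muMax⁻¹ ≤ m⁻¹ := inv_anti₀ hm h2
  have hb : m⁻¹ ≤ muMin⁻¹ := inv_anti₀ hmin h1
  have hm' : 0 < m⁻¹ := inv_pos.2 hm
  have hadv : inner ℝ (m⁻¹ • u • w) j ≤ V / (2 * muMin) * (‖j‖ ^ 2 + u ^ 2) := by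
    calc inner ℝ (m⁻¹ • u • w) j ≤ ‖m⁻¹ • u • w‖ * ‖j‖ := real_inner_le_norm _ _
      _ = m⁻¹ * ‖w‖ * (|u| * ‖j‖) := by
          rw [norm_smul, norm_smul, Real.norm_of_nonneg hm'.le, Real.norm_eq_abs]; ring
      _ ≤ muMin⁻¹ * V * (|u| * ‖j‖) := by gcongr
      -- Young's inequality; its factor `1/2` is the source of the `2` in the smallness condition on
      -- `𝐯`.
      _ ≤ muMin⁻¹ * V * ((‖j‖ ^ 2 + u ^ 2) / 2) := by
          gcongr
          nlinarith [sq_nonneg (|u| - ‖j‖), sq_abs u]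
      _ = V / (2 * muMin) * (‖j‖ ^ 2 + u ^ 2) := by field_simp
  have hdiff : min muMax⁻¹ rMin * ‖j‖ ^ 2 ≤ inner ℝ (m⁻¹ • j) j := by
    rw [real_inner_smul_left, real_inner_self_eq_norm_sq]
    have := (min_le_left muMax⁻¹ rMin).trans ha
    gcongr
  have hreac : min muMax⁻¹ rMin * u ^ 2 ≤ r * u * u := by
    rw [mul_assoc, ← pow_two]
    have := (min_le_right muMax⁻¹ rMin).trans hr
    gcongr
  linarith

namespace Data.Admissible

variable {d : Data} {Ω : Set E3} {Ωs : Fin 2 → Set E3} {muMin muMax rMin rMax : ℝ}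

theorem exists_energy_lower_bound (hd : d.Admissible Ω Ωs muMin muMax rMin rMax) :
    ∃ c > 0, ∀ (j : E3 → E3) (u : E3 → ℝ), ∀ᵐ x ∂volume.restrict Ω,
      c * (‖j x‖ ^ 2 + u x ^ 2) ≤ inner ℝ ((d.mu x)⁻¹ • j x) (j x)
        - inner ℝ ((d.mu x)⁻¹ • u x • d.vel x) (j x) + d.r x * u x * u x := by
  have hmin := hd.muMin_pos
  refine ⟨min muMax⁻¹ rMin - (eLpNorm d.vel ⊤ (volume.restrict Ω)).toReal / (2 * muMin), ?_, ?_⟩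
  -- Positivity of this constant is exactly the smallness assumption on `𝐯`.
  · rw [gt_iff_lt, sub_pos, div_lt_iff₀ (by positivity), mul_comm]
    exact hd.vel_small
  · intro j u
    filter_upwards [hd.mu_bounds, hd.r_bounds, hd.ae_norm_vel_le] with x h1 h2 h3
    exact energy_lower_bound hmin h1.1 h1.2 h2.1 h3

end Data.Admissible

/-- On an open set the derivative `b • id` is determined by the values, which gives `b = 0`; one
point then gives `a = 0`. -/
theorem RT0.eq_zero_of_eqOn {τ : RT0} {U : Set E3} (hU : IsOpen U) (hne : U.Nonempty)
    (h : Set.EqOn (τ : E3 → E3) 0 U) : τ = 0 := by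
  obtain ⟨a, b, hab⟩ := RT0.exists_eq τ
  obtain ⟨x, hx⟩ := hne
  have hd : fderiv ℝ (τ : E3 → E3) x = b • ContinuousLinearMap.id ℝ E3 := by
    rw [hab]
    exact ((b • ContinuousLinearMap.id ℝ E3).hasFDerivAt.const_add a).fderiv
  have hd0 : fderiv ℝ (τ : E3 → E3) x = 0 := by
    rw [(h.eventuallyEq_of_mem (hU.mem_nhds hx)).fderiv_eq]
    simp
  have hb : b = 0 := by
    have h1 := congrArg (fun L : E3 →L[ℝ] E3 => L (EuclideanSpace.single 0 1) 0)
      (hd.symm.trans hd0)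
    simpa using h1
  have ha : a = 0 := by
    have h1 := h hx
    rw [hab] at h1
    simpa [hb] using h1
  refine Subtype.ext ?_
  rw [hab, ha, hb]
  funext y
  simp

theorem P0.eq_zero_of_apply_eq_zero {φ : P0} {x : E3} (h : (φ : E3 → ℝ) x = 0) : φ = 0 := by
  refine Subtype.ext ?_
  rw [P0.eq_const, ← congrFun (P0.eq_const φ) x, h]
  rfl

theorem setIntegral_face {F : Finset E3} (c : ℝ) :
    ∫ _ in hull F, c ∂area = (area (hull F)).toReal * c := by
  simp [Measure.real]

namespace Mesh

variable {Ω : Set E3} {Ωs : Fin 2 → Set E3} {M : Mesh Ω Ωs} {d : Data}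
  {muMin muMax rMin rMax : ℝ}

/-- The energy of `u` on the element `K`. -/
noncomputable def energy (M : Mesh Ω Ωs) (d : Data) (u : M.Vh) (i : Fin 2) (K : M.elems i) : ℝ :=
  ∫ x in hull K, (inner ℝ ((d.mu x)⁻¹ • u.flux i K x) (u.flux i K x)
    - inner ℝ ((d.mu x)⁻¹ • u.primal i K x • d.vel x) (u.flux i K x)
    + d.r x * u.primal i K x * u.primal i K x)

section Energy

variable (hΩ : IsInterfaceDomain Ω Ωs) (hd : d.Admissible Ω Ωs muMin muMax rMin rMax)

include hΩ hd

theorem energy_nonneg (u : M.Vh) (i : Fin 2) (K : M.elems i) : 0 ≤ M.energy d u i K := by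
  obtain ⟨c, hc, h⟩ := hd.exists_energy_lower_bound
  refine integral_nonneg_of_ae ?_
  filter_upwards [ae_mono (M.restrict_hull_le hΩ K.2) (h (u.flux i K) (u.primal i K))] with x hx
  exact le_trans (by positivity) hx

theorem eq_zero_of_energy_eq_zero {u : M.Vh} {i : Fin 2} {K : M.elems i}
    (h0 : M.energy d u i K = 0) : (u i).1 K = 0 ∧ (u i).2 K = 0 := by
  obtain ⟨c, hc, h⟩ := hd.exists_energy_lower_bound
  have hK := ae_mono (M.restrict_hull_le hΩ K.2) (h (u.flux i K) (u.primal i K))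
  have hint := ((integrableOn_diffusion hΩ hd K (u.continuous_flux i K)
    (u.continuous_flux i K)).sub (integrableOn_advection hΩ hd K (u.continuous_primal i K)
    (u.continuous_flux i K))).add (integrableOn_reaction hΩ hd K (u.continuous_primal i K)
    (u.continuous_primal i K))
  have hz := (setIntegral_eq_zero_iff_of_nonneg_ae
    (by filter_upwards [hK] with x hx using le_trans (by positivity) hx) hint).1 h0
  have hsum : ∀ᵐ x ∂volume.restrict (hull K),
      ‖u.flux i K x‖ ^ 2 + u.primal i K x ^ 2 = 0 := by
    filter_upwards [hK, hz] with x hx hx0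
    have hle : c * (‖u.flux i K x‖ ^ 2 + u.primal i K x ^ 2) ≤ 0 := hx.trans hx0.le
    have hnn : 0 ≤ ‖u.flux i K x‖ ^ 2 + u.primal i K x ^ 2 := by positivity
    nlinarith
  have hcont : Continuous fun x => ‖u.flux i K x‖ ^ 2 + u.primal i K x ^ 2 :=
    ((u.continuous_flux i K).norm.pow 2).add ((u.continuous_primal i K).pow 2)
  -- A continuous function vanishing almost everywhere on an open set vanishes everywhere on it; the
  -- interior of a nondegenerate element is nonempty.
  have heq := Measure.eqOn_open_of_ae_eq (g := 0)
    (ae_mono (Measure.restrict_mono interior_subset le_rfl) hsum) isOpen_interior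
    hcont.continuousOn continuousOn_const
  have hne := interior_hull_nonempty (M.card_eq i K K.2) (M.affineIndep i K K.2)
  have hboth : ∀ x ∈ interior (hull K), u.flux i K x = 0 ∧ u.primal i K x = 0 := by
    intro x hx
    have h1 : ‖u.flux i K x‖ ^ 2 + u.primal i K x ^ 2 = 0 := heq hx
    rw [add_eq_zero_iff_of_nonneg (by positivity) (by positivity)] at h1
    exact ⟨by simpa using h1.1, by simpa using h1.2⟩
  obtain ⟨x, hx⟩ := hne
  exact ⟨RT0.eq_zero_of_eqOn isOpen_interior ⟨x, hx⟩ fun y hy => (hboth y hy).1,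
    P0.eq_zero_of_apply_eq_zero (hboth x hx).2⟩

end Energy

/-! ### Weighted test functions -/

/-- Multiplication by a constant in each subregion. -/
def Vh.scale (w : Fin 2 → ℝ) (u : M.Vh) : M.Vh := fun i => w i • u i

theorem Vh.flux_scale (w : Fin 2 → ℝ) (u : M.Vh) (i : Fin 2) (K : M.elems i) :
    (u.scale w).flux i K = w i • u.flux i K := rfl

theorem Vh.primal_scale (w : Fin 2 → ℝ) (u : M.Vh) (i : Fin 2) (K : M.elems i) :
    (u.scale w).primal i K = w i • u.primal i K := rfl

theorem Vh.divergence_flux_scale (w : Fin 2 → ℝ) (u : M.Vh) (i : Fin 2) (K : M.elems i)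
    (x : E3) : divergence ((u.scale w).flux i K) x = w i * divergence (u.flux i K) x :=
  (RT0.isLinearMap_divergence x).map_smul (w i) ((u i).1 K)

/-- The two divergence terms carry the same weight in each subregion and opposite signs, so they
cancel. -/
theorem formA_scale (hΩ : IsInterfaceDomain Ω Ωs)
    (hd : d.Admissible Ω Ωs muMin muMax rMin rMax) (w : Fin 2 → ℝ) (u : M.Vh) :
    M.formA d u (u.scale w) = ∑ i, w i * ∑ K : M.elems i, M.energy d u i K := by
  refine Finset.sum_congr rfl fun i _ => ?_
  have hen : ∀ K : M.elems i, M.energy d u i K =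
      (∫ x in hull K, inner ℝ ((d.mu x)⁻¹ • u.flux i K x) (u.flux i K x))
      - (∫ x in hull K, inner ℝ ((d.mu x)⁻¹ • u.primal i K x • d.vel x) (u.flux i K x))
      + ∫ x in hull K, d.r x * u.primal i K x * u.primal i K x := by
    intro K
    have h1 := integrableOn_diffusion hΩ hd K (u.continuous_flux i K) (u.continuous_flux i K)
    have h2 := integrableOn_advection hΩ hd K (u.continuous_primal i K) (u.continuous_flux i K)
    have h3 := integrableOn_reaction hΩ hd K (u.continuous_primal i K) (u.continuous_primal i K)
    exact (integral_add (h1.sub h2) h3).trans (congrArg (· + _) (integral_sub h1 h2))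
  -- This precedes `Vh.flux_scale`, which would destroy the pattern inside the divergence.
  simp only [Vh.divergence_flux_scale]
  simp only [Vh.flux_scale, Vh.primal_scale, Pi.smul_apply, hen,
    real_inner_smul_right, smul_eq_mul, mul_left_comm _ (w i), mul_assoc, integral_const_mul,
    ← Finset.mul_sum, Finset.sum_add_distrib, Finset.sum_sub_distrib]
  ring

/-- The weights of the two subregions, proportional to the inverse of `Data.seg`. -/
def weight (d : Data) : Fin 2 → ℝ := ![d.kappa, 1]

theorem weight_mul_seg (d : Data) (i : Fin 2) : weight d i * d.seg i = d.kappa := by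
  fin_cases i <;> simp [weight, Data.seg]

theorem weight_pos (hκ : 0 < d.kappa) (i : Fin 2) : 0 < weight d i := by
  fin_cases i <;> simp [weight, hκ]

/-- The test function in `𝒬_h` for which only the Robin term of `c` survives. -/
def Qh.weighted (d : Data) (p : M.Qh) : M.Qh :=
  (fun i F => weight d i • p.1 i F, fun i F => weight d i • p.2.1 i F, fun F => d.kappa • p.2.2 F)

theorem Qh.hybrid_weighted (p : M.Qh) (i : Fin 2) (F : M.faces i) (x : E3) :
    (p.weighted d).hybrid i F x = weight d i * p.hybrid i F x := rfl

theorem Qh.interfaceFlux_weighted (p : M.Qh) (i : Fin 2) (F : M.interfaceFacesOf i) (x : E3) :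
    (p.weighted d).interfaceFlux i F x = weight d i * p.interfaceFlux i F x := rfl

theorem Qh.multiplier_weighted (p : M.Qh) (F : M.interfaceFaces) (x : E3) :
    (p.weighted d).multiplier F x = d.kappa * p.multiplier F x := rfl

/-- The form `b` does not couple the subregions, so a weight constant on each can be carried by
either argument. -/
theorem formB_weighted (u : M.Vh) (p : M.Qh) :
    M.formB u (p.weighted d) = M.formB (u.scale (weight d)) p := by
  simp only [formB, Qh.hybrid_weighted, Vh.flux_scale, Pi.smul_apply, real_inner_smul_left,
    mul_left_comm, mul_assoc]

theorem sum_interfaceFacesOf (i : Fin 2) (f : M.interfaceFacesOf i → ℝ) :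
    ∑ F, f F = ∑ F : M.interfaceFaces, f (M.ifFaceOf i F) :=
  Fintype.sum_equiv ⟨M.ofIfFace, M.ifFaceOf i, fun _ => rfl, fun _ => rfl⟩ _ _ fun _ => rfl

/-- The pairings of `𝒥_i` with `û_i` are skew and cancel under a common weight. Those of `𝒥_i` with
`λ` cancel because the weight times `κ_i` equals `κ`, the scaling of the multiplier. -/
theorem formC_weighted (p : M.Qh) :
    M.formC d p (p.weighted d) = ∑ i, weight d i * ∑ F : M.boundaryFaces i,
      ∫ x in hull F, d.alpha x * p.hybrid i (M.bdFace F) x * p.hybrid i (M.bdFace F) x ∂area := by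
  refine Finset.sum_congr rfl fun i _ => ?_
  have h1 : ∀ F : M.boundaryFaces i, ∫ x in hull F, d.alpha x * p.hybrid i (M.bdFace F) x *
      (p.weighted d).hybrid i (M.bdFace F) x ∂area = weight d i *
      ∫ x in hull F, d.alpha x * p.hybrid i (M.bdFace F) x * p.hybrid i (M.bdFace F) x ∂area := by
    intro F
    rw [← integral_const_mul]
    refine integral_congr_ae (Filter.Eventually.of_forall fun x => ?_)
    simp only [Qh.hybrid_weighted]
    ring
  have h2 : ∀ F : M.interfaceFacesOf i, ∫ x in hull F,
      (p.weighted d).interfaceFlux i F x * p.hybrid i (M.ifFace F) x ∂area =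
      ∫ x in hull F, p.interfaceFlux i F x * (p.weighted d).hybrid i (M.ifFace F) x ∂area := by
    intro F
    refine integral_congr_ae (Filter.Eventually.of_forall fun x => ?_)
    simp only [Qh.hybrid_weighted, Qh.interfaceFlux_weighted]
    ring
  have h3 : ∀ F : M.interfaceFaces, ∫ x in hull (M.ifFaceOf i F : Finset E3),
      (p.weighted d).interfaceFlux i (M.ifFaceOf i F) x *
        (d.seg i * p.multiplier (M.ofIfFace (M.ifFaceOf i F)) x) ∂area =
      ∫ x in hull F,
        p.interfaceFlux i (M.ifFaceOf i F) x * (p.weighted d).multiplier F x ∂area := by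
    intro F
    refine integral_congr_ae (Filter.Eventually.of_forall fun x => ?_)
    simp only [Qh.multiplier_weighted, Qh.interfaceFlux_weighted, ← weight_mul_seg d i]
    -- Viewing a face of `Γ` as one of `ℱ_{h,Γ,i}` and back is the identity by definition.
    change _ * (_ * p.multiplier F x) = _
    ring
  rw [sum_interfaceFacesOf i fun F => ∫ x in hull F, (p.weighted d).interfaceFlux i F x *
    (d.seg i * p.multiplier (M.ofIfFace F) x) ∂area]
  simp only [h1, h2, h3, ← Finset.mul_sum]
  ring

theorem formC_weighted_nonneg (hd : d.Admissible Ω Ωs muMin muMax rMin rMax) (p : M.Qh) :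
    0 ≤ M.formC d p (p.weighted d) := by
  classical
  rw [formC_weighted]
  refine Finset.sum_nonneg fun i _ => mul_nonneg (weight_pos hd.kappa_pos i).le
    (Finset.sum_nonneg fun F _ => integral_nonneg_of_ae ?_)
  filter_upwards [ae_mono (Measure.restrict_mono (Finset.mem_filter.1 F.2).2 le_rfl)
    hd.alpha_pos] with x hx
  change 0 ≤ _
  rw [mul_assoc]
  exact mul_nonneg hx.le (mul_self_nonneg _)

/-! ### Recovering the hybrid unknowns -/

/-- The vertex-centred field `x ↦ x - P`. -/
def vertexField (P : E3) : RT0 := ⟨fun x => x - P, -P, 1, fun x => by module⟩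

/-- The field whose normal component on every face is a positive multiple of the hybrid variable. -/
noncomputable def Qh.lift (p : M.Qh) : M.Vh := fun i =>
  (fun K => ∑ P : (K : Finset E3),
    p.hybrid i ⟨oppFace K P, M.oppFace_mem K.2 P.2⟩ 0 • vertexField (P : E3), 0)

theorem Qh.flux_lift (p : M.Qh) (i : Fin 2) (K : M.elems i) (x : E3) :
    p.lift.flux i K x = ∑ P : (K : Finset E3),
      p.hybrid i ⟨oppFace K P, M.oppFace_mem K.2 P.2⟩ 0 • (x - (P : E3)) := by
  simp [Vh.flux, Qh.lift, vertexField]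

theorem oppFace_nonempty (M : Mesh Ω Ωs) {i : Fin 2} {K : Finset E3} (hK : K ∈ M.elems i)
    {P : E3} (hP : P ∈ K) : (oppFace K P).Nonempty := by
  classical
  rw [← Finset.card_pos, oppFace, Finset.card_erase_of_mem hP, M.card_eq i K hK]
  norm_num

/-- For `P ≠ Q` the vertex `P` lies on the face opposite `Q`, so `x - P` is tangential there. Only
the summand of `Q` survives, and its normal component is the height. -/
theorem Qh.inner_flux_lift (p : M.Qh) (i : Fin 2) (K : M.elems i) (Q : (K : Finset E3)) {x : E3}
    (hx : x ∈ hull (oppFace K Q)) : inner ℝ (p.lift.flux i K x) (outwardNormal K Q) =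
      p.hybrid i ⟨oppFace K Q, M.oppFace_mem K.2 Q.2⟩ 0 * ‖normalDir K Q‖ := by
  rw [p.flux_lift, sum_inner, Finset.sum_eq_single Q]
  · rw [real_inner_smul_left, inner_sub_outwardNormal_self (M.oppFace_nonempty K.2 Q.2) hx]
  · intro P _ hPQ
    rw [real_inner_smul_left,
      inner_sub_outwardNormal_of_ne P.2 (fun h => hPQ (Subtype.ext h)) hx, mul_zero]
  · exact fun h => absurd (Finset.mem_univ _) h

theorem formB_lift (p : M.Qh) : M.formB p.lift p =
    ∑ i : Fin 2, ∑ K : M.elems i, ∑ P : (K : Finset E3), (area (hull (oppFace K P))).toReal *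
      (‖normalDir K P‖ * p.hybrid i ⟨oppFace K P, M.oppFace_mem K.2 P.2⟩ 0 ^ 2) := by
  refine Finset.sum_congr rfl fun i _ => Finset.sum_congr rfl fun K _ =>
    Finset.sum_congr rfl fun P _ => ?_
  rw [← setIntegral_face]
  refine setIntegral_congr_fun (isCompact_hull _).measurableSet fun x hx => ?_
  simp only [p.inner_flux_lift i K P hx]
  have : p.hybrid i ⟨oppFace K P, M.oppFace_mem K.2 P.2⟩ x =
      p.hybrid i ⟨oppFace K P, M.oppFace_mem K.2 P.2⟩ 0 := congrFun (P0.eq_const _) x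
  rw [this]
  ring

/-- A face shared by two elements contributes twice, but with the same sign, since the lift is built
separately on each element. Each term has positive area and height as factors. -/
theorem hybrid_eq_zero_of_formB_lift {p : M.Qh} (h : M.formB p.lift p = 0) : p.1 = 0 := by
  rw [formB_lift] at h
  have hnn : ∀ i : Fin 2, ∀ K : M.elems i, ∀ P : (K : Finset E3),
      0 ≤ (area (hull (oppFace K P))).toReal *
      (‖normalDir K P‖ * p.hybrid i ⟨oppFace K P, M.oppFace_mem K.2 P.2⟩ 0 ^ 2) :=
    fun i K P => by positivity
  funext i F
  obtain ⟨K, hK, P, hP, hF⟩ := M.exists_oppFace_of_mem_faces F.2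
  have h1 := (Finset.sum_eq_zero_iff_of_nonneg fun i _ => Finset.sum_nonneg fun K _ =>
    Finset.sum_nonneg fun P _ => hnn i K P).1 h i (Finset.mem_univ _)
  have h2 := (Finset.sum_eq_zero_iff_of_nonneg fun K _ => Finset.sum_nonneg fun P _ =>
    hnn i K P).1 h1 ⟨K, hK⟩ (Finset.mem_univ _)
  have h3 := (Finset.sum_eq_zero_iff_of_nonneg fun P _ => hnn i ⟨K, hK⟩ P).1 h2 ⟨P, hP⟩
    (Finset.mem_univ _)
  have hFeq : F = ⟨oppFace K P, M.oppFace_mem hK hP⟩ := Subtype.ext hF.symm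
  rw [hFeq]
  have harea := area_hull_oppFace (M.card_eq i K hK) (M.affineIndep i K hK) hP
  have hpos := ENNReal.toReal_pos harea.1.ne' harea.2.ne
  have hnorm := norm_pos_iff.2
    (normalDir_ne_zero (M.affineIndep i K hK) hP (M.oppFace_nonempty hK hP))
  have h4 := (mul_eq_zero.1 ((mul_eq_zero.1 h3).resolve_left hpos.ne')).resolve_left hnorm.ne'
  exact P0.eq_zero_of_apply_eq_zero (pow_eq_zero_iff two_ne_zero |>.1 h4)

/-! ### Recovering the interface unknowns -/

open Classical in
/-- The test function that detects the interface flux and the multiplier. -/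
noncomputable def Qh.interfaceTest (d : Data) (p : M.Qh) : M.Qh :=
  (fun i F => if h : (F : Finset E3) ∈ M.interfaceFacesOf i then p.2.1 i ⟨F, h⟩ else 0,
    fun i F => d.seg i • p.2.2 (M.ofIfFace F), 0)

theorem Qh.hybrid_interfaceTest (p : M.Qh) (i : Fin 2) (F : M.interfaceFacesOf i) :
    (p.interfaceTest d).hybrid i (M.ifFace F) = p.interfaceFlux i F := by
  have h : ((M.ifFace F : M.faces i) : Finset E3) ∈ M.interfaceFacesOf i := F.2
  simp only [Qh.hybrid, Qh.interfaceTest, dif_pos h]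
  rfl

/-- With the hybrid part of `p` zero, only the pairings of `ρ_i` with `κ_i λ` and of `𝒥_i` with
`μ_i` remain, and the test function makes both into squares. -/
theorem formC_interfaceTest {p : M.Qh} (hp : p.1 = 0) : M.formC d p (p.interfaceTest d) =
    ∑ i : Fin 2, ∑ F : M.interfaceFacesOf i, (area (hull F)).toReal *
      ((d.seg i * p.multiplier (M.ofIfFace F) 0) ^ 2 + p.interfaceFlux i F 0 ^ 2) := by
  refine Finset.sum_congr rfl fun i _ => ?_
  have h0 : ∀ (F : M.faces i) (x : E3), p.hybrid i F x = 0 := by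
    intro F x
    simp [Qh.hybrid, hp]
  have h1 : ∀ F : M.interfaceFaces, (p.interfaceTest d).multiplier F = 0 := fun _ => rfl
  have h2 : ∀ (F : M.interfaceFacesOf i) (x : E3), (p.interfaceTest d).interfaceFlux i F x =
    d.seg i * p.multiplier (M.ofIfFace F) x := fun _ _ => rfl
  have h3 : ∀ (F : M.interfaceFacesOf i) (x : E3), p.interfaceFlux i F x =
    p.interfaceFlux i F 0 := fun F x => congrFun (P0.eq_const _) x
  have h4 : ∀ (F : M.interfaceFaces) (x : E3), p.multiplier F x =
    p.multiplier F 0 := fun F x => congrFun (P0.eq_const _) x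
  simp only [h0, h1, h2, Qh.hybrid_interfaceTest, Pi.zero_apply, mul_zero, zero_mul,
    integral_zero, Finset.sum_const_zero, sub_zero, zero_add]
  rw [← Finset.sum_add_distrib]
  refine Finset.sum_congr rfl fun F _ => ?_
  simp only [h3 F, h4, setIntegral_face]
  ring

theorem eq_zero_of_formC_interfaceTest (hκ : 0 < d.kappa) {p : M.Qh} (hp : p.1 = 0)
    (h : M.formC d p (p.interfaceTest d) = 0) : p = 0 := by
  rw [formC_interfaceTest hp] at h
  have hnn : ∀ i : Fin 2, ∀ F : M.interfaceFacesOf i, 0 ≤ (area (hull F)).toReal *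
      ((d.seg i * p.multiplier (M.ofIfFace F) 0) ^ 2 + p.interfaceFlux i F 0 ^ 2) :=
    fun i F => by positivity
  have hall : ∀ i : Fin 2, ∀ F : M.interfaceFacesOf i,
      p.multiplier (M.ofIfFace F) 0 = 0 ∧ p.interfaceFlux i F 0 = 0 := by
    intro i F
    have h1 := (Finset.sum_eq_zero_iff_of_nonneg fun i _ => Finset.sum_nonneg fun F _ =>
      hnn i F).1 h i (Finset.mem_univ _)
    have h2 := (Finset.sum_eq_zero_iff_of_nonneg fun F _ => hnn i F).1 h1 F (Finset.mem_univ _)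
    have harea := M.area_hull_face (M.ifFace F).2
    have h3 := (mul_eq_zero.1 h2).resolve_left (ENNReal.toReal_pos harea.1.ne' harea.2.ne).ne'
    rw [add_eq_zero_iff_of_nonneg (by positivity) (by positivity)] at h3
    -- The weight times `d.seg i` is `κ > 0`, so neither factor vanishes.
    have hseg : d.seg i ≠ 0 := fun hs => hκ.ne' (by rw [← weight_mul_seg d i, hs, mul_zero])
    exact ⟨(mul_eq_zero.1 (pow_eq_zero_iff two_ne_zero |>.1 h3.1)).resolve_left hseg,
      pow_eq_zero_iff two_ne_zero |>.1 h3.2⟩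
  refine Prod.ext hp (Prod.ext ?_ ?_)
  · funext i F
    exact P0.eq_zero_of_apply_eq_zero (hall i F).2
  · funext F
    -- Every face on `Γ` is a face of both triangulations, so either side determines the multiplier.
    exact P0.eq_zero_of_apply_eq_zero (hall 0 (M.ifFaceOf 0 F)).1

/-! ### Uniqueness and existence -/

theorem eq_zero_of_homogeneous (hΩ : IsInterfaceDomain Ω Ωs)
    (hd : d.Admissible Ω Ωs muMin muMax rMin rMax) {u : M.Vh} {p : M.Qh}
    (hu : ∀ v, M.formA d u v + M.formB v p = 0)
    (hp : ∀ q, M.formB u q - M.formC d p q = 0) : u = 0 ∧ p = 0 := by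
  -- Subtracting the second tested equation from the first cancels `b` and leaves `c` with a plus
  -- sign.
  have hsum : (∑ i, weight d i * ∑ K : M.elems i, M.energy d u i K) +
      M.formC d p (p.weighted d) = 0 := by
    have h1 := hu (u.scale (weight d))
    have h2 := hp (p.weighted d)
    rw [formA_scale hΩ hd] at h1
    rw [formB_weighted] at h2
    linarith
  have hnn : ∀ i, 0 ≤ weight d i * ∑ K : M.elems i, M.energy d u i K := fun i =>
    mul_nonneg (weight_pos hd.kappa_pos i).le
      (Finset.sum_nonneg fun K _ => energy_nonneg hΩ hd u i K)
  have hE := ((add_eq_zero_iff_of_nonneg (Finset.sum_nonneg fun i _ => hnn i)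
    (formC_weighted_nonneg hd p)).1 hsum).1
  have hK : ∀ (i : Fin 2) (K : M.elems i), (u i).1 K = 0 ∧ (u i).2 K = 0 := by
    intro i K
    have h1 := (Finset.sum_eq_zero_iff_of_nonneg fun i _ => hnn i).1 hE i (Finset.mem_univ _)
    have h2 := (mul_eq_zero.1 h1).resolve_left (weight_pos hd.kappa_pos i).ne'
    exact eq_zero_of_energy_eq_zero hΩ hd ((Finset.sum_eq_zero_iff_of_nonneg fun K _ =>
      energy_nonneg hΩ hd u i K).1 h2 K (Finset.mem_univ _))
  have hu0 : u = 0 := funext fun i => Prod.ext (funext fun K => (hK i K).1)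
    (funext fun K => (hK i K).2)
  subst hu0
  refine ⟨rfl, ?_⟩
  have hhyb : p.1 = 0 := by
    refine hybrid_eq_zero_of_formB_lift ?_
    have h0 : M.formA d 0 p.lift = 0 := ((isBilin_formA hΩ hd).1 p.lift).map_zero
    rw [← hu p.lift, h0, zero_add]
  refine eq_zero_of_formC_interfaceTest hd.kappa_pos hhyb ?_
  have h := hp (p.interfaceTest d)
  have h0 : M.formB 0 (p.interfaceTest d) = 0 := (isBilin_formB.1 (p.interfaceTest d)).map_zero
  linarith

/-- The discrete problem as a single variational equation on `𝒱_h × 𝒬_h`. -/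
theorem isSolution_iff (hΩ : IsInterfaceDomain Ω Ωs)
    (hd : d.Admissible Ω Ωs muMin muMax rMin rMax) {F : M.Vh → ℝ} {G : M.Qh → ℝ}
    (hF : IsLinearMap ℝ F) (hG : IsLinearMap ℝ G) (u : M.Vh) (p : M.Qh) :
    ((∀ v, M.formA d u v + M.formB v p = F v) ∧ ∀ q, M.formB u q - M.formC d p q = G q) ↔
      ∀ w : M.Vh × M.Qh, (M.formA d u w.1 + M.formB w.1 p) + (M.formB u w.2 - M.formC d p w.2) =
        F w.1 + G w.2 := by
  refine ⟨fun h w => by rw [h.1, h.2], fun h => ⟨fun v => ?_, fun q => ?_⟩⟩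
  · have h1 : M.formB u 0 = 0 := (isBilin_formB.2 u).map_zero
    have h2 : M.formC d p 0 = 0 := ((isBilin_formC hd).2 p).map_zero
    simpa [h1, h2, hG.map_zero] using h (v, 0)
  · have h1 : M.formA d u 0 = 0 := ((isBilin_formA hΩ hd).2 u).map_zero
    have h2 : M.formB 0 p = 0 := (isBilin_formB.1 p).map_zero
    simpa [h1, h2, hF.map_zero] using h (0, q)

theorem isBilin_combined (hΩ : IsInterfaceDomain Ω Ωs)
    (hd : d.Admissible Ω Ωs muMin muMax rMin rMax) :
    IsBilin fun z w : M.Vh × M.Qh =>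
      (M.formA d z.1 w.1 + M.formB w.1 z.2) + (M.formB z.1 w.2 - M.formC d z.2 w.2) := by
  let π₁ := LinearMap.fst ℝ M.Vh M.Qh
  let π₂ := LinearMap.snd ℝ M.Vh M.Qh
  exact ((((isBilin_formA hΩ hd).compLeft π₁).compRight π₁).add
    ((isBilin_formB.swap.compLeft π₂).compRight π₁)).add
    (((isBilin_formB.compLeft π₁).compRight π₂).sub
      (((isBilin_formC hd).compLeft π₂).compRight π₂))

theorem existsUnique_isSolution (hΩ : IsInterfaceDomain Ω Ωs)
    (hd : d.Admissible Ω Ωs muMin muMax rMin rMax) :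
    ∃! w : M.Vh × M.Qh, M.IsSolution d w.1 w.2 := by
  have hF := isLinearMap_rhsF (M := M) hΩ hd
  have hG := isLinearMap_rhsG (M := M) hd
  have hFG : IsLinearMap ℝ fun w : M.Vh × M.Qh => M.rhsF d w.1 + M.rhsG d w.2 :=
    isLinearMap_add (hF.mk' _ ∘ₗ LinearMap.fst ℝ M.Vh M.Qh).isLinear
      (hG.mk' _ ∘ₗ LinearMap.snd ℝ M.Vh M.Qh).isLinear
  have h := (isBilin_combined (M := M) hΩ hd).existsUnique_of_forall_eq_zero
    (fun z hz => ?_) hFG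
  · simpa only [IsSolution, isSolution_iff hΩ hd hF hG] using h
  -- The same equivalence with zero right-hand sides splits the combined equation into the
  -- homogeneous system.
  · have hz' := (isSolution_iff hΩ hd (0 : M.Vh →ₗ[ℝ] ℝ).isLinear (0 : M.Qh →ₗ[ℝ] ℝ).isLinear
      z.1 z.2).2 fun w => by simpa using hz w
    obtain ⟨h1, h2⟩ := eq_zero_of_homogeneous hΩ hd (fun v => hz'.1 v) (fun q => hz'.2 q)
    exact Prod.ext h1 h2

end Mesh

end DMH

theorem mainTheorem2 (Ω : Set DMH.E3) (Ωs : Fin 2 → Set DMH.E3)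
    (hΩ : DMH.IsInterfaceDomain Ω Ωs) (M : DMH.Mesh Ω Ωs) (d : DMH.Data)
    (muMin muMax rMin rMax : ℝ) (hd : d.Admissible Ω Ωs muMin muMax rMin rMax) :
    ∃! w : M.Vh × M.Qh, M.IsSolution d w.1 w.2 :=
  DMH.Mesh.existsUnique_isSolution hΩ hd
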